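/- Let $k$ be an algebraically closed field of characteristic $0$, let $A=k[X,Y]$, and let $f\in A$ be an irreducible polynomial with coordinate ring $R=A/(f)$ and function field $k(f)=\mathrm{Frac}(R)$. A place of $f$ is a valuation ring $V\subsetneq k(f)$ with $k\subset V$; it is a place at infinity if $R\not\subset V$, and a branch at finite distance if $R\subset V$. A branch at finite distance with valuation ring $V$ and maximal ideal $\mathfrak m_V$ is called singular (cuspidal) if $\mathfrak m_V\cap R\subset \mathfrak m_V^2$. Suppose that we are in Situation 2, that is: * $f$ has exactly one place at infinity; * $\mu(f;A)=\nu(f)+1$, where $\mu(f;A)$ is the length of $A/(f_X,f_Y)$ and $\nu(f)$ is the length of $A/(f,f_X,f_Y)$; * $n=\deg_Y f=4$ and $m=\deg_X f=3$. We say that a curve $g\in A$ has the parametric form $x=u(t),\ y=v(t)$, with $u,v\in k[t]$, if the kernel of the $k$-algebra map $A\to k[t]$, $X\mapsto u$, $Y\mapsto v$, is $(g)$ and $k(u,v)=k(t)$. Then: 1. If $f$ has at least one singular branch at finite distance, there are a $k$-algebra automorphism $\sigma$ of $A$ and $a\in\{0,-8,-9\}$ such that $\sigma(f)$ has the parametric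 form $$x=t^4+at^2,\qquad y=t^3-3t^2.$$ 2. If $f$ has no singular branch at finite distance, there are a $k$-algebra automorphism $\sigma$ of $A$ and $a,b\in k$ with $a=-1$ and $b\ne\pm1$ such that $\sigma(f)$ has the parametric form $$x=(t^2-1)(t^2+a),\qquad y=(t^2-1)(t+b).$$ -/

import Mathlib

namespace PlaneCurve

variable {k : Type*} [Field k]

/-- The coordinate ring `R = k[X, Y] / (f)`; the coordinates are `X = X 0` and `Y = X 1`. -/
abbrev CoordRing (f : MvPolynomial (Fin 2) k) : Type _ :=
  MvPolynomial (Fin 2) k ⧸ Ideal.span {f}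

instance (f : MvPolynomial (Fin 2) k) [hf : Fact (Irreducible f)] : IsDomain (CoordRing f) :=
  (Ideal.Quotient.isDomain_iff_prime _).2
    ((Ideal.span_singleton_prime hf.out.ne_zero).2 hf.out.prime)

/-- The function field `k(f)` of the irreducible curve `f = 0`. -/
abbrev FunctionField (f : MvPolynomial (Fin 2) k) [Fact (Irreducible f)] : Type _ :=
  FractionRing (CoordRing f)

/-- A valuation ring of the function field over `k` (a place of the curve): it contains `k` and is
not the whole field. -/
def IsPlace (f : MvPolynomial (Fin 2) k) [Fact (Irreducible f)]
    (V : ValuationSubring (FunctionField f)) : Prop :=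
  (∀ c : k, algebraMap k (FunctionField f) c ∈ V) ∧ V ≠ ⊤

/-- A branch at finite distance: a place whose valuation ring contains the coordinate ring. -/
def IsFiniteBranch (f : MvPolynomial (Fin 2) k) [Fact (Irreducible f)]
    (V : ValuationSubring (FunctionField f)) : Prop :=
  IsPlace f V ∧ ∀ r : CoordRing f, algebraMap (CoordRing f) (FunctionField f) r ∈ V

/-- A place at infinity: a place whose valuation ring does not contain the coordinate ring. -/
def IsPlaceAtInfinity (f : MvPolynomial (Fin 2) k) [Fact (Irreducible f)]
    (V : ValuationSubring (FunctionField f)) : Prop :=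
  IsPlace f V ∧ ¬ ∀ r : CoordRing f, algebraMap (CoordRing f) (FunctionField f) r ∈ V

/-- The curve has exactly one place at infinity. -/
def HasOnePlaceAtInfinity (f : MvPolynomial (Fin 2) k) [Fact (Irreducible f)] : Prop :=
  ∃! V : ValuationSubring (FunctionField f), IsPlaceAtInfinity f V

/-- A singular (cuspidal) branch at finite distance: a branch along which every element of the
coordinate ring that vanishes at the centre of the branch has order at least two. -/
def IsSingularBranch (f : MvPolynomial (Fin 2) k) [Fact (Irreducible f)]
    (V : ValuationSubring (FunctionField f)) : Prop :=
  IsFiniteBranch f V ∧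
    ∀ (r : CoordRing f) (h : algebraMap (CoordRing f) (FunctionField f) r ∈ V),
      (⟨algebraMap (CoordRing f) (FunctionField f) r, h⟩ : V) ∈ IsLocalRing.maximalIdeal V →
      (⟨algebraMap (CoordRing f) (FunctionField f) r, h⟩ : V) ∈ IsLocalRing.maximalIdeal V ^ 2

/-- The ideal `J_f = (f_X, f_Y)` of `k[X, Y]`. -/
noncomputable def jacobianIdeal (f : MvPolynomial (Fin 2) k) : Ideal (MvPolynomial (Fin 2) k) :=
  Ideal.span {MvPolynomial.pderiv 0 f, MvPolynomial.pderiv 1 f}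

/-- The Milnor number of the pencil `(f - a)`, `a ∈ k`: the length of `A / (f_X, f_Y)`. -/
noncomputable def milnorPencil (f : MvPolynomial (Fin 2) k) : ℕ∞ :=
  Module.length (MvPolynomial (Fin 2) k) (MvPolynomial (Fin 2) k ⧸ jacobianIdeal f)

/-- The affine Tjurina number of `f`: the length of `A / (f, f_X, f_Y)`. -/
noncomputable def tjurina (f : MvPolynomial (Fin 2) k) : ℕ∞ :=
  Module.length (MvPolynomial (Fin 2) k)
    (MvPolynomial (Fin 2) k ⧸ (Ideal.span {f} ⊔ jacobianIdeal f))

/-- A curve with one place at infinity, `μ(f; A) = ν(f) + 1`, and degrees `n = deg_Y f = 4`,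
`m = deg_X f = 3`. -/
structure IsSituationTwo (f : MvPolynomial (Fin 2) k) [Fact (Irreducible f)] : Prop where
  onePlace : HasOnePlaceAtInfinity f
  milnor_eq : milnorPencil f = tjurina f + 1
  degree_Y : MvPolynomial.degreeOf 1 f = 4
  degree_X : MvPolynomial.degreeOf 0 f = 3

/-- `x = u(t)`, `y = v(t)` is a parametric form of the curve `g = 0`: the polynomials vanishing on
the parametrized curve are the multiples of `g`, and the parametrization is birational, that is,
`k(u, v) = k(t)`. -/
def IsParametrizedBy (g : MvPolynomial (Fin 2) k) (u v : Polynomial k) : Prop :=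
  RingHom.ker (MvPolynomial.aeval ![u, v] : MvPolynomial (Fin 2) k →ₐ[k] Polynomial k)
      = Ideal.span {g} ∧
    IntermediateField.adjoin k
      {algebraMap (Polynomial k) (RatFunc k) u, algebraMap (Polynomial k) (RatFunc k) v} = ⊤

end PlaneCurve

/-!
Since `f` has one place at infinity, the functions `x` and `y` have their only pole there, and the
norms of `x` and `y` compare the pole orders with `deg_Y f` and `deg_X f`. These degrees being
coprime, the top weighted part of `f` for the weights `4, 3` has both corners `X³` and `Y⁴` and
nothing lies above it, so a triangular automorphism brings `f` to the miniversal unfolding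
`X³ + 3 (a Y² + b Y + c) X + Y⁴ + d Y² + e Y + g` of the `E₆` singularity.

The condition `μ = ν + 1` says that `f` generates an ideal of length one in `A / (f_X, f_Y)`. Its
annihilator is the maximal ideal of a point `(α, β)`, whence `(X - α) f` and `(Y - β) f` lie in
`(f_X, f_Y)`. Replacing `f` by its defect in Euler's weighted homogeneity formula and comparing
degrees turns these two memberships into polynomial equations for `a, …, g, α, β`. Their solutions
with `f ∉ (f_X, f_Y)` form four one-parameter families, the parameter `s` being the scaling of
weight one in Euler's grading, and each family is parametrized explicitly: three by
`(t⁴ + l t², t³ - 3 t²)` with `l = 0, -8, -9`, one by `((t² - 1)², t (t² - 1))`.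

A parametrization identifies `k(f)` with `k(t)` and the branches at finite distance with the points
`t = c` of the line; such a branch is singular exactly when `c` is a common critical point of `u`
and `v`. The first three curves have the critical point `t = 0` and the last one has none, so the
two cases of the theorem are told apart.
-/

namespace PlaneCurve

open Polynomial

section UniqueExtension

theorem isIntegral_of_forall_mem_valuationSubring {R K : Type*} [CommRing R] [Field K]
    [Algebra R K] {z : K}
    (h : ∀ W : ValuationSubring K, (∀ r, algebraMap R K r ∈ W) → z ∈ W) : IsIntegral R z := by
  by_contra hz
  obtain ⟨V, hV, hzV⟩ := Subring.exists_le_valuationSubring_of_isIntegrallyClosedIn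
    (R := (integralClosure R K).toSubring) hz
  exact hzV (h V fun r => hV ((integralClosure R K).algebraMap_mem r))

theorem exists_norm_eq_coeff_zero_minpoly_pow {F K : Type*} [Field F] [Field K] [Algebra F K]
    [FiniteDimensional F K] (w : K) :
    ∃ e ≠ 0, Algebra.norm F w =
      ((-1) ^ (minpoly F w).natDegree * (minpoly F w).coeff 0) ^ e := by
  have hw : IsIntegral F w := Algebra.IsIntegral.isIntegral w
  refine ⟨Module.finrank (IntermediateField.adjoin F {w}) K, Module.finrank_pos.ne', ?_⟩
  rw [Algebra.norm_eq_norm_adjoin, ← IntermediateField.adjoin.powerBasis_gen hw,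
    Algebra.PowerBasis.norm_gen_eq_coeff_zero_minpoly, IntermediateField.adjoin.powerBasis_gen,
    IntermediateField.adjoin.powerBasis_dim, IntermediateField.minpoly_gen]

variable {F K : Type*} [Field F] [Field K] [Algebra F K] {V : ValuationSubring K}

theorem minpoly_coeff_mem
    (hV : ∀ W : ValuationSubring K,
      V.comap (algebraMap F K) ≤ W.comap (algebraMap F K) → V ≤ W)
    {w : K} (hw : w ∈ V) (i : ℕ) : algebraMap F K ((minpoly F w).coeff i) ∈ V := by
  let O : ValuationSubring F := V.comap (algebraMap F K)
  let : Algebra O K := ((algebraMap F K).comp O.subtype).toAlgebra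
  have : IsScalarTower O F K := IsScalarTower.of_algebraMap_eq fun _ => rfl
  have hint : IsIntegral O w :=
    isIntegral_of_forall_mem_valuationSubring fun W hW => hV W (fun g hg => hW ⟨g, hg⟩) hw
  rw [minpoly.isIntegrallyClosed_eq_field_fractions' F hint, coeff_map]
  exact ((minpoly O w).coeff i).2

theorem valuation_coeff_zero_minpoly_le
    (hV : ∀ W : ValuationSubring K,
      V.comap (algebraMap F K) ≤ W.comap (algebraMap F K) → V ≤ W)
    {w : K} (hw : w ∈ V) :
    V.valuation (algebraMap F K ((minpoly F w).coeff 0)) ≤ V.valuation w := by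
  have hroot : algebraMap F K ((minpoly F w).coeff 0) = -(aeval w (minpoly F w).divX * w) := by
    have := congrArg (aeval w) (divX_mul_X_add (minpoly F w))
    rw [minpoly.aeval, map_add, map_mul, aeval_X, aeval_C] at this
    exact eq_neg_of_add_eq_zero_right this
  have hmem : aeval w (minpoly F w).divX ∈ V := by
    rw [aeval_eq_sum_range]
    refine sum_mem fun i _ => ?_
    rw [Algebra.smul_def, coeff_divX]
    exact V.mul_mem _ _ (minpoly_coeff_mem hV hw _) (pow_mem hw i)
  rw [hroot, Valuation.map_neg, map_mul]
  exact mul_le_of_le_one_left' ((V.valuation_le_one_iff _).2 hmem)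

variable [FiniteDimensional F K]

theorem valuation_norm_le
    (hV : ∀ W : ValuationSubring K,
      V.comap (algebraMap F K) ≤ W.comap (algebraMap F K) → V ≤ W)
    {w : K} (hw : w ∈ V) :
    V.valuation (algebraMap F K (Algebra.norm F w)) ≤ V.valuation w := by
  obtain ⟨e, he, hnorm⟩ := exists_norm_eq_coeff_zero_minpoly_pow (F := F) w
  have hc := valuation_coeff_zero_minpoly_le hV hw
  rw [hnorm]
  simp only [map_pow, map_mul, map_neg, map_one, Valuation.map_neg, one_pow, one_mul]
  exact (pow_le_of_le_one zero_le (hc.trans ((V.valuation_le_one_iff w).2 hw)) he).trans hc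

theorem valuation_eq_one_of_norm_eq_one
    (hV : ∀ W : ValuationSubring K,
      V.comap (algebraMap F K) ≤ W.comap (algebraMap F K) → V ≤ W)
    {w : K} (hw : Algebra.norm F w = 1) : V.valuation w = 1 := by
  have key {z : K} (hz : z ∈ V) (hn : Algebra.norm F z = 1) : V.valuation z = 1 := by
    refine le_antisymm ((V.valuation_le_one_iff z).2 hz) ?_
    simpa only [hn, map_one] using valuation_norm_le hV hz
  rcases V.mem_or_inv_mem w with h | h
  · exact key h hw
  · rw [← inv_inv w, map_inv₀, key h (by rw [Algebra.norm_inv, hw, inv_one]), inv_one]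

theorem valuation_pow_finrank_eq_valuation_norm
    (hV : ∀ W : ValuationSubring K,
      V.comap (algebraMap F K) ≤ W.comap (algebraMap F K) → V ≤ W) (w : K) :
    V.valuation w ^ Module.finrank F K = V.valuation (algebraMap F K (Algebra.norm F w)) := by
  have hd : Module.finrank F K ≠ 0 := Module.finrank_pos.ne'
  rcases eq_or_ne w 0 with rfl | hw
  · rw [Algebra.norm_zero, map_zero, map_zero, map_zero, zero_pow hd]
  have hn : Algebra.norm F w ≠ 0 := Algebra.norm_ne_zero_iff.2 hw
  have hunit : V.valuation (w ^ Module.finrank F K / algebraMap F K (Algebra.norm F w)) = 1 := by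
    refine valuation_eq_one_of_norm_eq_one hV ?_
    rw [div_eq_mul_inv, map_mul, Algebra.norm_inv, map_pow, Algebra.norm_algebraMap,
      mul_inv_cancel₀ (pow_ne_zero _ hn)]
  rw [map_div₀, map_pow] at hunit
  refine (div_eq_one_iff_eq ?_).1 hunit
  rwa [Valuation.ne_zero_iff, _root_.map_ne_zero]

end UniqueExtension

section UniquePole

/-- The field `K` over `k` has no place other than `V` at which `x` or `y` has a pole. -/
structure IsUniquePole (k : Type*) {K : Type*} [Field k] [Field K] [Algebra k K]
    (V : ValuationSubring K) (x y : K) : Prop where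
  algebraMap_mem : ∀ c : k, algebraMap k K c ∈ V
  eq_of_notMem : ∀ W : ValuationSubring K, (∀ c : k, algebraMap k K c ∈ W) →
    x ∉ W ∨ y ∉ W → W = V

theorem isTrivialOn_valuation {k K : Type*} [Field k] [Field K] [Algebra k K]
    {V : ValuationSubring K} (hk : ∀ c : k, algebraMap k K c ∈ V) : V.valuation.IsTrivialOn k where
  eq_one c hc := (V.valuation_eq_one_iff ⟨_, hk c⟩).1 <|
    .of_mul_eq_one ⟨_, hk c⁻¹⟩ (Subtype.ext (by simp [hc]))

theorem one_lt_valuation_iff {K : Type*} [Field K] {V : ValuationSubring K} {x : K} :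
    1 < V.valuation x ↔ x ∉ V := by
  rw [← V.valuation_le_one_iff, not_le]

theorem eq_top_of_forall_algebraMap_mem {F K : Type*} [Field F] [Field K] [Algebra F K]
    [Algebra.IsIntegral F K] {W : ValuationSubring K} (h : ∀ g : F, algebraMap F K g ∈ W) :
    W = ⊤ := by
  refine top_unique fun z _ => ?_
  let _ : Algebra F W.toSubring := ((algebraMap F K).codRestrict W.toSubring h).toAlgebra
  have : IsScalarTower F W.toSubring K := IsScalarTower.of_algebraMap_eq fun _ => rfl
  have hz : IsIntegral W.toSubring z := (Algebra.IsIntegral.isIntegral (R := F) z).tower_top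
  exact LocalSubring.mem_of_isMax_of_isIntegral W.isMax_toLocalSubring hz

theorem transcendental_algebraMap_X {k K : Type*} [Field k] [Field K] [Algebra k K]
    [Algebra k[X] K] [IsScalarTower k k[X] K] [FaithfulSMul k[X] K] :
    Transcendental k (algebraMap k[X] K X) :=
  (transcendental_algebraMap_iff (FaithfulSMul.algebraMap_injective _ _)).2 (transcendental_X k)

namespace IsUniquePole

variable {k K : Type*} [Field k] [Field K] [Algebra k K] {x y : K} {V : ValuationSubring K}

theorem notMem (hV : IsUniquePole k V x y) (hx : Transcendental k x) : x ∉ V := by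
  refine fun hxV => hx (IsIntegral.isAlgebraic ?_)
  refine isIntegral_of_forall_mem_valuationSubring fun W hW => ?_
  by_contra hxW
  exact hxW (hV.eq_of_notMem W hW (.inl hxW) ▸ hxV)

theorem valuation_aeval (hV : IsUniquePole k V x y) (hx : Transcendental k x) {p : k[X]}
    (hp : p ≠ 0) : V.valuation (aeval x p) = V.valuation x ^ p.natDegree :=
  have := isTrivialOn_valuation hV.algebraMap_mem
  valuation_aeval_eq_valuation_X_pow_natDegree_of_one_lt_valuation_X x
    (one_lt_valuation_iff.2 (hV.notMem hx)) hp

variable [Algebra k[X] K] [IsScalarTower k k[X] K] [FaithfulSMul k[X] K]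

theorem isIntegral (hV : IsUniquePole k V (algebraMap k[X] K X) y) : IsIntegral k[X] y := by
  refine isIntegral_of_forall_mem_valuationSubring fun W hW => ?_
  by_contra hy
  refine hV.notMem transcendental_algebraMap_X (hV.eq_of_notMem W (fun c => ?_) (.inr hy) ▸ hW X)
  rw [IsScalarTower.algebraMap_apply k k[X] K]
  exact hW _

variable {F : Type*} [Field F] [Algebra k[X] F] [IsFractionRing k[X] F] [Algebra F K]
  [IsScalarTower k[X] F K]

theorem exists_div_pow_mem (hV : IsUniquePole k V (algebraMap k[X] K X) y) (g : F) :
    ∃ n : ℕ, algebraMap F K (g / algebraMap k[X] F X ^ n) ∈ V := by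
  obtain ⟨p, q, hq, rfl⟩ := IsFractionRing.div_surjective (A := k[X]) g
  rcases eq_or_ne p 0 with rfl | hp
  · exact ⟨0, by simpa only [map_zero, zero_div] using V.zero_mem⟩
  have hval {r : k[X]} (hr : r ≠ 0) : V.valuation (algebraMap k[X] K r) =
      V.valuation (algebraMap k[X] K X) ^ r.natDegree := by
    rw [← hV.valuation_aeval transcendental_algebraMap_X hr, aeval_algebraMap_apply,
      aeval_X_left_apply]
  have hX : 1 < V.valuation (algebraMap k[X] K X) :=
    one_lt_valuation_iff.2 (hV.notMem transcendental_algebraMap_X)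
  refine ⟨p.natDegree, ?_⟩
  rw [← V.valuation_le_one_iff]
  simp only [map_div₀, map_pow, ← IsScalarTower.algebraMap_apply]
  rw [hval hp, hval (nonZeroDivisors.ne_zero hq), div_right_comm,
    div_self (pow_ne_zero _ (zero_lt_one.trans hX).ne'), one_div]
  exact inv_le_one_of_one_le₀ (one_le_pow₀ hX.le)

theorem le_of_comap_le [Algebra.IsIntegral F K]
    (hV : IsUniquePole k V (algebraMap k[X] K X) y) (W : ValuationSubring K)
    (hW : V.comap (algebraMap F K) ≤ W.comap (algebraMap F K)) : V ≤ W := by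
  by_cases hxW : algebraMap k[X] K X ∈ W
  · suffices W = ⊤ from this ▸ le_top
    refine eq_top_of_forall_algebraMap_mem (F := F) fun g => ?_
    obtain ⟨n, hn⟩ := hV.exists_div_pow_mem g
    have hX : algebraMap k[X] F X ≠ 0 := by simp
    rw [← div_mul_cancel₀ g (pow_ne_zero n hX), map_mul, map_pow,
      ← IsScalarTower.algebraMap_apply k[X] F K X]
    exact W.mul_mem _ _ (hW hn) (pow_mem hxW n)
  · refine (hV.eq_of_notMem W (fun c => ?_) (.inl hxW)).ge
    have hc : algebraMap k K c = algebraMap F K (algebraMap k[X] F (C c)) := by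
      rw [← IsScalarTower.algebraMap_apply, IsScalarTower.algebraMap_apply k k[X] K,
        Polynomial.algebraMap_eq]
    have hmem := hV.algebraMap_mem c
    rw [hc] at hmem ⊢
    exact hW hmem

theorem valuation_pow_natDegree_minpoly_eq
    (hV : IsUniquePole k V (algebraMap k[X] K X) y) (hy : y ≠ 0)
    (htop : IntermediateField.adjoin F {y} = ⊤) :
    V.valuation y ^ (minpoly k[X] y).natDegree =
      V.valuation (algebraMap k[X] K X) ^ ((minpoly k[X] y).coeff 0).natDegree := by
  have hint := hV.isIntegral
  have hintF : IsIntegral F y := hint.tower_top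
  have hmin : minpoly F y = (minpoly k[X] y).map (algebraMap k[X] F) :=
    minpoly.isIntegrallyClosed_eq_field_fractions' F hint
  have hcoeff : algebraMap k[X] F ((minpoly k[X] y).coeff 0) = (minpoly F y).coeff 0 := by
    rw [hmin, coeff_map]
  have hcoeff_ne : (minpoly k[X] y).coeff 0 ≠ 0 := fun h =>
    minpoly.coeff_zero_ne_zero hintF hy (by rw [← hcoeff, h, map_zero])
  have hadjoin : Algebra.adjoin F {y} = ⊤ := by
    rw [← IntermediateField.adjoin_simple_toSubalgebra_of_isAlgebraic hintF.isAlgebraic, htop,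
      IntermediateField.top_toSubalgebra]
  let pb : PowerBasis F K := .ofAdjoinEqTop hintF hadjoin
  have hgen : pb.gen = y := PowerBasis.ofAdjoinEqTop_gen hintF hadjoin
  have : FiniteDimensional F K := pb.finite
  have hdim : Module.finrank F K = (minpoly k[X] y).natDegree := by
    rw [pb.finrank, ← pb.natDegree_minpoly, hgen, hmin, (minpoly.monic hint).natDegree_map]
  have hnorm : Algebra.norm F y = (-1) ^ pb.dim * (minpoly F y).coeff 0 := by
    rw [← hgen, Algebra.PowerBasis.norm_gen_eq_coeff_zero_minpoly]
  rw [← hdim, valuation_pow_finrank_eq_valuation_norm hV.le_of_comap_le, hnorm, ← hcoeff]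
  simp only [map_pow, map_mul, map_neg, map_one, Valuation.map_neg, one_pow, one_mul,
    ← IsScalarTower.algebraMap_apply]
  rw [← hV.valuation_aeval transcendental_algebraMap_X hcoeff_ne, aeval_algebraMap_apply,
    aeval_X_left_apply]

theorem isUnit_leadingCoeff (hV : IsUniquePole k V (algebraMap k[X] K X) y) {P : k[X][X]}
    (hP : Irreducible P) (hy : aeval y P = 0) : IsUnit P.leadingCoeff :=
  (minpoly.IsIntegrallyClosed.isIntegral_iff_isUnit_leadingCoeff hP hy).1 hV.isIntegral

theorem valuation_pow_natDegree_eq (hV : IsUniquePole k V (algebraMap k[X] K X) y)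
    (hy : y ≠ 0) (htop : IntermediateField.adjoin F {y} = ⊤) {P : k[X][X]} (hP : Irreducible P)
    (hPy : aeval y P = 0) :
    V.valuation y ^ P.natDegree =
      V.valuation (algebraMap k[X] K X) ^ (P.coeff 0).natDegree := by
  have hint := hV.isIntegral
  obtain ⟨q, hq⟩ := minpoly.isIntegrallyClosed_dvd hint hPy
  obtain ⟨u, hu, rfl⟩ := Polynomial.isUnit_iff.1
    ((of_irreducible_mul (hq ▸ hP)).resolve_left (minpoly.not_isUnit _ _))
  have hdeg : P.natDegree = (minpoly k[X] y).natDegree := by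
    rw [hq, natDegree_mul_C hu.ne_zero]
  have hcoeff : (P.coeff 0).natDegree = ((minpoly k[X] y).coeff 0).natDegree := by
    obtain ⟨c, hc, rfl⟩ := Polynomial.isUnit_iff.1 hu
    rw [hq, coeff_mul_C, natDegree_mul_C hc.ne_zero]
  rw [hdeg, hcoeff, hV.valuation_pow_natDegree_minpoly_eq hy htop]

end IsUniquePole

end UniquePole

section ToPoly

variable {R : Type*} [CommSemiring R]

/-- Bivariate polynomials as polynomials in the coordinate `X i`, with coefficients that are
polynomials in the other coordinate. -/
noncomputable def toPoly (i : Fin 2) : MvPolynomial (Fin 2) R ≃ₐ[R] R[X][X] :=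
  (MvPolynomial.renameEquiv R (Equiv.swap i 0)).trans
    ((MvPolynomial.finSuccEquiv R 1).trans
      (Polynomial.mapAlgEquiv (MvPolynomial.uniqueAlgEquiv R (Fin 1))))

theorem toPoly_X_self (i : Fin 2) : toPoly (R := R) i (MvPolynomial.X i) = X := by
  simp [toPoly, MvPolynomial.finSuccEquiv_X_zero, Polynomial.coe_mapAlgEquiv]

theorem toPoly_X_of_ne {i j : Fin 2} (h : j ≠ i) :
    toPoly (R := R) i (MvPolynomial.X j) = C X := by
  have : Equiv.swap i 0 j = Fin.succ 0 := by
    revert i j; decide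
  rw [toPoly, AlgEquiv.trans_apply, AlgEquiv.trans_apply, MvPolynomial.renameEquiv_apply,
    MvPolynomial.rename_X, this, MvPolynomial.finSuccEquiv_X_succ]
  simp [MvPolynomial.uniqueAlgEquiv]

theorem eval₂_toPoly {S : Type*} [CommSemiring S] [Algebra R S] {i j : Fin 2} (h : j ≠ i)
    (z : Fin 2 → S) (f : MvPolynomial (Fin 2) R) :
    eval₂ (aeval (R := R) (z j) : R[X] →+* S) (z i) (toPoly i f) = MvPolynomial.aeval z f := by
  induction f using MvPolynomial.induction_on with
  | C c =>
    rw [← MvPolynomial.algebraMap_eq, AlgEquiv.commutes, AlgHom.commutes,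
      Polynomial.algebraMap_apply, eval₂_C, RingHom.coe_coe, AlgHom.commutes]
  | add p q hp hq => rw [map_add, map_add, eval₂_add, hp, hq]
  | mul_X p l hp =>
    rw [map_mul, map_mul, eval₂_mul, hp, MvPolynomial.aeval_X]
    congr 1
    obtain rfl | rfl : l = i ∨ l = j := by omega
    · rw [toPoly_X_self, eval₂_X]
    · rw [toPoly_X_of_ne h, eval₂_C, RingHom.coe_coe, aeval_X]

theorem toPoly_toMvPolynomial {i j : Fin 2} (h : j ≠ i) (p : R[X]) :
    toPoly i (p.toMvPolynomial j) = C p := by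
  have : (toPoly i).toAlgHom.comp (toMvPolynomial (R := R) j) = CAlgHom := by
    ext; simp [toPoly_X_of_ne h]
  exact DFunLike.congr_fun this p

theorem natDegree_toPoly (i : Fin 2) (f : MvPolynomial (Fin 2) R) :
    (toPoly i f).natDegree = f.degreeOf i := by
  rw [toPoly, AlgEquiv.trans_apply, AlgEquiv.trans_apply, Polynomial.coe_mapAlgEquiv,
    natDegree_map_eq_of_injective (MvPolynomial.uniqueAlgEquiv R (Fin 1)).injective,
    MvPolynomial.natDegree_finSuccEquiv, MvPolynomial.renameEquiv_apply]
  have := MvPolynomial.degreeOf_rename_of_injective (p := f) (Equiv.injective (Equiv.swap i 0)) i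
  rwa [Equiv.swap_apply_left] at this

theorem coeff_toPoly {i j : Fin 2} (h : j ≠ i) (f : MvPolynomial (Fin 2) R) (a b : ℕ) :
    ((toPoly i f).coeff a).coeff b = f.coeff (Finsupp.single i a + Finsupp.single j b) := by
  have hswap : Finsupp.cons a (Finsupp.single default b) =
      (Finsupp.single i a + Finsupp.single j b).mapDomain (Equiv.swap i 0) := by
    have hj : Equiv.swap i 0 j = Fin.succ default := by
      revert i j; decide
    rw [Finsupp.mapDomain_add, Finsupp.mapDomain_single, Finsupp.mapDomain_single,
      Equiv.swap_apply_left, hj]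
    ext l
    refine Fin.cases ?_ (fun l => ?_) l
    · simp
    · rw [Finsupp.cons_succ]
      simp [Subsingleton.elim l default]
  rw [toPoly, AlgEquiv.trans_apply, AlgEquiv.trans_apply, Polynomial.coe_mapAlgEquiv, coeff_map,
    RingHom.coe_coe, MvPolynomial.coeff_uniqueAlgEquiv, MvPolynomial.finSuccEquiv_coeff_coeff,
    hswap, MvPolynomial.renameEquiv_apply,
    MvPolynomial.coeff_rename_mapDomain _ (Equiv.injective _)]

end ToPoly

section FunctionField

variable {k : Type*} [Field k] {f : MvPolynomial (Fin 2) k} [hf : Fact (Irreducible f)]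

variable (f) in
/-- The restriction of a polynomial to the curve `f = 0`, as an element of the function field. -/
noncomputable def toFunctionField : MvPolynomial (Fin 2) k →ₐ[k] FunctionField f :=
  (IsScalarTower.toAlgHom k (CoordRing f) (FunctionField f)).comp
    (Ideal.Quotient.mkₐ k (Ideal.span {f}))

theorem toFunctionField_apply (g : MvPolynomial (Fin 2) k) : toFunctionField f g =
    algebraMap (CoordRing f) (FunctionField f) (Ideal.Quotient.mk _ g) := rfl

theorem toFunctionField_eq_zero_iff {g : MvPolynomial (Fin 2) k} :
    toFunctionField f g = 0 ↔ f ∣ g := by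
  rw [toFunctionField_apply, map_eq_zero_iff _ (IsFractionRing.injective _ _),
    Ideal.Quotient.eq_zero_iff_mem, Ideal.mem_span_singleton]

theorem exists_eq_div_toFunctionField (z : FunctionField f) :
    ∃ p q, z = toFunctionField f p / toFunctionField f q := by
  obtain ⟨p, q, -, rfl⟩ := IsFractionRing.div_surjective (A := CoordRing f) z
  obtain ⟨p, rfl⟩ := Ideal.Quotient.mk_surjective p
  obtain ⟨q, rfl⟩ := Ideal.Quotient.mk_surjective q
  exact ⟨p, q, rfl⟩

theorem aeval_toFunctionField_X (g : MvPolynomial (Fin 2) k) :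
    MvPolynomial.aeval (fun i => toFunctionField f (.X i)) g = toFunctionField f g :=
  (DFunLike.congr_fun (MvPolynomial.aeval_unique (toFunctionField f)) g).symm

theorem forall_algebraMap_mem_iff {V : ValuationSubring (FunctionField f)}
    (hV : ∀ c : k, algebraMap k (FunctionField f) c ∈ V) :
    (∀ r : CoordRing f, algebraMap (CoordRing f) (FunctionField f) r ∈ V) ↔
      ∀ i, toFunctionField f (.X i) ∈ V := by
  refine ⟨fun h i => h _, fun h r => ?_⟩
  obtain ⟨g, rfl⟩ := Ideal.Quotient.mk_surjective r
  rw [← toFunctionField_apply]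
  induction g using MvPolynomial.induction_on with
  | C c => exact (toFunctionField f).commutes c ▸ hV c
  | add p q hp hq => rw [map_add]; exact V.add_mem _ _ hp hq
  | mul_X p l hp => rw [map_mul]; exact V.mul_mem _ _ hp (h l)

theorem HasOnePlaceAtInfinity.exists_isUniquePole (h : HasOnePlaceAtInfinity f) :
    ∃ V, ∀ i j : Fin 2,
      IsUniquePole k V (toFunctionField f (.X j)) (toFunctionField f (.X i)) := by
  obtain ⟨V, hV, huniq⟩ := h
  refine ⟨V, fun i j => ⟨hV.1.1, fun W hW hxy => huniq W ⟨⟨hW, ?_⟩, ?_⟩⟩⟩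
  · rintro rfl
    exact hxy.elim (fun h => h (ValuationSubring.mem_top _)) fun h => h (ValuationSubring.mem_top _)
  · rw [forall_algebraMap_mem_iff hW]
    exact fun h => hxy.elim (fun hj => hj (h j)) fun hi => hi (h i)

theorem transcendental_toFunctionField_X {i j : Fin 2} (hij : j ≠ i) (hi : f.degreeOf i ≠ 0) :
    Transcendental k (toFunctionField f (.X j)) := by
  rw [transcendental_iff]
  intro p hp
  rw [Polynomial.aeval_algHom_apply, toFunctionField_eq_zero_iff] at hp
  obtain ⟨q, hq⟩ := hp
  have hC : toPoly i (f * q) = C p := by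
    rw [← hq, ← toPoly_toMvPolynomial hij]; rfl
  by_contra hp0
  have hq0 : f * q ≠ 0 := by
    rintro h
    rw [h, map_zero] at hC
    exact hp0 (C_eq_zero.1 hC.symm)
  have hdeg := natDegree_toPoly i (f * q)
  rw [hC, natDegree_C, MvPolynomial.degreeOf_mul_eq (left_ne_zero_of_mul hq0)
    (right_ne_zero_of_mul hq0)] at hdeg
  omega

theorem isUnit_leadingCoeff_and_valuation_pow_eq {V : ValuationSubring (FunctionField f)}
    {i j : Fin 2} (hij : j ≠ i)
    (hV : IsUniquePole k V (toFunctionField f (.X j)) (toFunctionField f (.X i)))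
    (hi : f.degreeOf i ≠ 0) :
    IsUnit (toPoly i f).leadingCoeff ∧ ((toPoly i f).coeff 0 ≠ 0 →
      V.valuation (toFunctionField f (.X i)) ^ f.degreeOf i =
        V.valuation (toFunctionField f (.X j)) ^ ((toPoly i f).coeff 0).natDegree) := by
  have htrans := transcendental_toFunctionField_X hij hi
  let _ : Algebra k[X] (FunctionField f) := (aeval (toFunctionField f (.X j))).toAlgebra
  have : IsScalarTower k k[X] (FunctionField f) := .of_algebraMap_eq fun c =>
    ((aeval (R := k) (toFunctionField f (.X j))).commutes c).symm
  have : FaithfulSMul k[X] (FunctionField f) :=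
    (faithfulSMul_iff_algebraMap_injective _ _).2 (transcendental_iff_injective.1 htrans)
  have hX : algebraMap k[X] (FunctionField f) X = toFunctionField f (.X j) := aeval_X _
  have hirr : Irreducible (toPoly i f) := (MulEquiv.irreducible_iff (toPoly i)).2 hf.out
  have hroot (g : MvPolynomial (Fin 2) k) :
      aeval (toFunctionField f (.X i)) (toPoly i g) = toFunctionField f g :=
    (eval₂_toPoly hij _ g).trans (aeval_toFunctionField_X g)
  have hroot_self : aeval (toFunctionField f (.X i)) (toPoly i f) = 0 := by
    rw [hroot, toFunctionField_eq_zero_iff]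
  rw [← hX] at hV ⊢
  refine ⟨hV.isUnit_leadingCoeff hirr hroot_self, fun h0 => ?_⟩
  let _ : Algebra (FractionRing k[X]) (FunctionField f) := FractionRing.liftAlgebra _ _
  rw [← natDegree_toPoly]
  refine hV.valuation_pow_natDegree_eq (F := FractionRing k[X]) (fun hy => h0 ?_) ?_ hirr
    hroot_self
  · rw [hy, ← coeff_zero_eq_aeval_zero', map_eq_zero_iff _
      (FaithfulSMul.algebraMap_injective _ _)] at hroot_self
    exact hroot_self
  · refine top_unique fun z _ => ?_
    have hmem (g : MvPolynomial (Fin 2) k) : toFunctionField f g ∈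
        IntermediateField.adjoin (FractionRing k[X]) {toFunctionField f (.X i)} := by
      rw [← hroot g, ← aeval_map_algebraMap (FractionRing k[X])]
      exact IntermediateField.algebra_adjoin_le_adjoin _ _ (aeval_mem_adjoin_singleton _ _)
    obtain ⟨p, q, rfl⟩ := exists_eq_div_toFunctionField z
    exact div_mem (hmem p) (hmem q)

end FunctionField

section NewtonPolygon

theorem exists_ne_weight_eq_of_aeval_eq_zero {σ k K Γ : Type*} [Field k] [Field K]
    [Algebra k K] [LinearOrderedCommGroupWithZero Γ] {v : Valuation K Γ} [v.IsTrivialOn k]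
    {z : σ → K} {w : σ → ℕ} {N : ℕ} (hN : N ≠ 0) {t : Γ} (ht : 1 < t)
    (hz : ∀ s, v (z s) ^ N = t ^ w s) {f : MvPolynomial σ k} (hf : f ≠ 0)
    (h0 : MvPolynomial.aeval z f = 0) :
    ∃ d ∈ f.support, ∃ d' ∈ f.support, d ≠ d' ∧ Finsupp.weight w d = Finsupp.weight w d' ∧
      ∀ e ∈ f.support, Finsupp.weight w e ≤ Finsupp.weight w d := by
  classical
  have hmonomial (d) (hd : d ∈ f.support) :
      v (MvPolynomial.aeval z (.monomial d (f.coeff d))) ^ N = t ^ Finsupp.weight w d := by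
    rw [MvPolynomial.aeval_monomial, map_mul,
      Valuation.IsTrivialOn.eq_one _ (MvPolynomial.mem_support_iff.1 hd), one_mul,
      Finsupp.weight_apply, Finsupp.prod, Finsupp.sum, map_prod, ← Finset.prod_pow,
      ← Finset.prod_pow_eq_pow_sum]
    refine Finset.prod_congr rfl fun s _ => ?_
    rw [map_pow, pow_right_comm, hz, ← pow_mul, mul_comm, smul_eq_mul]
  obtain ⟨d, hd, hmax⟩ := f.support.exists_max_image (Finsupp.weight w)
    (MvPolynomial.support_nonempty.2 hf)
  by_contra! hcon
  have hval : v (MvPolynomial.aeval z f) = v (MvPolynomial.aeval z (.monomial d (f.coeff d))) := by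
    conv_lhs => rw [← f.support_sum_monomial_coeff, map_sum]
    refine Valuation.map_sum_eq_of_lt _ hd fun e he => lt_of_pow_lt_pow_left₀ N zero_le ?_
    rw [Finset.mem_sdiff, Finset.notMem_singleton] at he
    rw [hmonomial d hd, hmonomial e he.1]
    refine pow_lt_pow_right₀ ht ((hmax e he.1).lt_of_ne fun hw => ?_)
    obtain ⟨e', he', hlt⟩ := hcon d hd e he.1 he.2.symm hw.symm
    exact hlt.not_ge (hmax e' he')
  have := hmonomial d hd
  rw [← hval, h0, map_zero, zero_pow hN] at this
  exact pow_ne_zero _ (zero_lt_one.trans ht).ne' this.symm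

theorem weight_eq_mul_of_coprime {m n a b a' b' : ℕ} (hmn : m.Coprime n) (ha : a ≤ m)
    (hb : b ≤ n) (ha' : a' ≤ m) (hb' : b' ≤ n) (hne : ¬(a = a' ∧ b = b'))
    (h : n * a + m * b = n * a' + m * b') : n * a + m * b = n * m := by
  wlog hle : a ≤ a' generalizing a a' b b'
  · exact h.trans (this ha' hb' ha hb (by tauto) h.symm (by omega))
  have hdvd : m ∣ a' - a := by
    refine hmn.dvd_of_dvd_mul_left ⟨b - b', ?_⟩
    rw [Nat.mul_sub, Nat.mul_sub]
    omega
  rcases hle.eq_or_lt with rfl | hlt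
  · obtain rfl : m = 0 := by
      by_contra hm
      exact hne ⟨rfl, Nat.eq_of_mul_eq_mul_left (Nat.pos_of_ne_zero hm) (by omega)⟩
    simp [Nat.le_zero.1 ha]
  · have := Nat.le_of_dvd (by omega) hdvd
    obtain ⟨rfl, rfl⟩ : a = 0 ∧ a' = m := by omega
    nlinarith

variable {k : Type*} [Field k] {f : MvPolynomial (Fin 2) k} [hf : Fact (Irreducible f)]

theorem HasOnePlaceAtInfinity.coeff_single_degreeOf_ne_zero (h : HasOnePlaceAtInfinity f)
    {i : Fin 2} (hi : f.degreeOf i ≠ 0) : f.coeff (Finsupp.single i (f.degreeOf i)) ≠ 0 := by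
  obtain ⟨V, hV⟩ := h.exists_isUniquePole
  obtain ⟨j, hij⟩ := exists_ne i
  obtain ⟨c, hc, hc'⟩ := Polynomial.isUnit_iff.1
    (isUnit_leadingCoeff_and_valuation_pow_eq hij (hV i j) hi).1
  have hcoeff := coeff_toPoly hij f (f.degreeOf i) 0
  rw [← natDegree_toPoly, coeff_natDegree, ← hc', coeff_C_zero, natDegree_toPoly,
    Finsupp.single_zero, add_zero] at hcoeff
  exact hcoeff ▸ hc.ne_zero

theorem HasOnePlaceAtInfinity.natDegree_coeff_zero_toPoly (h : HasOnePlaceAtInfinity f)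
    {i j : Fin 2} (hij : j ≠ i) (hj : f.degreeOf j ≠ 0) :
    ((toPoly i f).coeff 0).natDegree = f.degreeOf j := by
  have hcoeff (n : ℕ) : ((toPoly i f).coeff 0).coeff n = f.coeff (Finsupp.single j n) := by
    rw [coeff_toPoly hij, Finsupp.single_zero, zero_add]
  refine natDegree_eq_of_le_of_coeff_ne_zero (natDegree_le_iff_coeff_eq_zero.2 fun n hn => ?_) ?_
  · rw [hcoeff]
    by_contra hne
    have := MvPolynomial.monomial_le_degreeOf j (MvPolynomial.mem_support_iff.2 hne)
    rw [Finsupp.single_eq_same] at this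
    omega
  · rw [hcoeff]
    exact h.coeff_single_degreeOf_ne_zero hj

theorem HasOnePlaceAtInfinity.weight_le (h : HasOnePlaceAtInfinity f)
    (h0 : f.degreeOf 0 ≠ 0) (h1 : f.degreeOf 1 ≠ 0)
    (hcop : (f.degreeOf 0).Coprime (f.degreeOf 1)) {d : Fin 2 →₀ ℕ} (hd : d ∈ f.support) :
    f.degreeOf 1 * d 0 + f.degreeOf 0 * d 1 ≤ f.degreeOf 1 * f.degreeOf 0 := by
  obtain ⟨V, hV⟩ := h.exists_isUniquePole
  have hV01 := hV 1 0
  have hpole : 1 < V.valuation (toFunctionField f (.X 0)) := one_lt_valuation_iff.2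
    (hV01.notMem (transcendental_toFunctionField_X (i := 1) (by decide) h1))
  have hdeg := h.natDegree_coeff_zero_toPoly (i := 1) (j := 0) (by decide) h0
  have hval := (isUnit_leadingCoeff_and_valuation_pow_eq (by decide) hV01 h1).2
    (ne_zero_of_natDegree_gt (n := 0) (by omega))
  rw [hdeg] at hval
  have := isTrivialOn_valuation hV01.algebraMap_mem
  have hweight (e : Fin 2 →₀ ℕ) : Finsupp.weight ![f.degreeOf 1, f.degreeOf 0] e =
      f.degreeOf 1 * e 0 + f.degreeOf 0 * e 1 := by
    rw [Finsupp.weight_eq_sum, Fin.sum_univ_two]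
    simp [mul_comm]
  obtain ⟨a, ha, b, hb, hne, heq, hmax⟩ := exists_ne_weight_eq_of_aeval_eq_zero (k := k) h1 hpole
    (w := ![f.degreeOf 1, f.degreeOf 0]) (z := fun i => toFunctionField f (.X i))
    (Fin.forall_fin_two.2 ⟨rfl, hval⟩) hf.out.ne_zero
    (by rw [aeval_toFunctionField_X, toFunctionField_eq_zero_iff])
  rw [hweight, hweight] at heq
  rw [← weight_eq_mul_of_coprime hcop (MvPolynomial.monomial_le_degreeOf 0 ha)
    (MvPolynomial.monomial_le_degreeOf 1 ha) (MvPolynomial.monomial_le_degreeOf 0 hb)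
    (MvPolynomial.monomial_le_degreeOf 1 hb) (fun h => hne ?_) heq]
  · simpa only [hweight] using hmax d hd
  · ext i
    fin_cases i
    exacts [h.1, h.2]

end NewtonPolygon

section Length

theorem isMaximal_colon_of_length_quotient {A : Type*} [CommRing A] {J : Ideal A} {f : A}
    (hJ : Module.length A (A ⧸ J) ≠ ⊤)
    (h : Module.length A (A ⧸ J) = Module.length A (A ⧸ (Ideal.span {f} ⊔ J)) + 1) :
    (J.colon {f}).IsMaximal := by
  let φ : A →ₗ[A] A ⧸ J := LinearMap.toSpanSingleton A _ (Submodule.Quotient.mk f)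
  have hker : LinearMap.ker φ = J.colon {f} := by
    ext r
    rw [LinearMap.mem_ker, LinearMap.toSpanSingleton_apply, ← Submodule.Quotient.mk_smul,
      Submodule.Quotient.mk_eq_zero, Submodule.mem_colon_singleton]
  have hexact : Function.Exact ((LinearMap.ker φ).liftQ φ le_rfl)
      (Submodule.factor (le_sup_right : J ≤ Ideal.span {f} ⊔ J)) := by
    rw [LinearMap.exact_iff, Submodule.range_liftQ]
    ext z
    obtain ⟨a, rfl⟩ := Submodule.Quotient.mk_surjective _ z
    rw [LinearMap.mem_ker, ← Submodule.mkQ_apply, Submodule.factor_mk, Submodule.mkQ_apply,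
      Submodule.Quotient.mk_eq_zero, Ideal.mem_span_singleton_sup, LinearMap.mem_range]
    refine exists_congr fun r => ?_
    rw [LinearMap.toSpanSingleton_apply, ← Submodule.Quotient.mk_smul, Submodule.mkQ_apply,
      Submodule.Quotient.eq, smul_eq_mul, ← neg_mem_iff, neg_sub]
    exact ⟨fun ⟨b, hb, h⟩ => by rwa [← h, add_sub_cancel_left],
      fun hr => ⟨a - r * f, hr, add_sub_cancel _ _⟩⟩
  have hadd := Module.length_eq_add_of_exact _ _
    (LinearMap.ker_eq_bot.1 (Submodule.ker_liftQ_eq_bot' _ φ rfl))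
    (Submodule.factor_surjective _) hexact
  have hfin : Module.length A (A ⧸ (Ideal.span {f} ⊔ J)) ≠ ⊤ := fun htop => hJ (by
    rw [h, htop, top_add])
  rw [h, add_comm (Module.length A (A ⧸ LinearMap.ker φ))] at hadd
  have hone := (ENat.addLECancellable_of_ne_top hfin).inj.1 hadd
  rw [← hker]
  exact ⟨isSimpleModule_iff_isCoatom.1 (Module.length_eq_one_iff.1 hone.symm)⟩

theorem exists_forall_sub_eval_mul_mem {σ k : Type*} [Finite σ] [Field k] [IsAlgClosed k]
    {J : Ideal (MvPolynomial σ k)} {f : MvPolynomial σ k} (h : (J.colon {f}).IsMaximal) :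
    ∃ p : σ → k, ∀ g, (g - .C (MvPolynomial.eval p g)) * f ∈ J := by
  obtain ⟨p, hp⟩ := MvPolynomial.isMaximal_iff_eq_vanishingIdeal_singleton.1 h
  refine ⟨p, fun g => ?_⟩
  rw [← smul_eq_mul, ← Submodule.mem_colon_singleton, hp,
    MvPolynomial.mem_vanishingIdeal_singleton_iff]
  simp

theorem length_quotient_map {A : Type*} [CommRing A] (σ : A ≃+* A) (I : Ideal A) :
    Module.length A (A ⧸ I.map σ) = Module.length A (A ⧸ I) := by
  rw [Module.length_quotient, Module.length_quotient, ← RingEquiv.idealComapOrderIso_symm_apply,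
    Order.coheight_orderIso]

end Length

section Jacobian

theorem derivation_aeval {σ k S : Type*} [Fintype σ] [CommRing k] [CommRing S] [Algebra k S]
    (D : Derivation k S S) (z : σ → S) (f : MvPolynomial σ k) :
    D (MvPolynomial.aeval z f) = ∑ i, MvPolynomial.aeval z (MvPolynomial.pderiv i f) * D (z i) := by
  classical
  induction f using MvPolynomial.induction_on with
  | C c => simp
  | add p q hp hq => simp only [map_add, hp, hq, add_mul, Finset.sum_add_distrib]
  | mul_X p j hp =>
    simp only [map_mul, Derivation.leibniz, hp, MvPolynomial.aeval_X, MvPolynomial.pderiv_X,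
      smul_eq_mul, map_add, add_mul, Finset.sum_add_distrib, Finset.mul_sum, mul_assoc,
      mul_left_comm (z j)]
    simp [Pi.single_apply, apply_ite]

variable {k : Type*} [Field k] {f : MvPolynomial (Fin 2) k}

theorem pderiv_mem_jacobianIdeal (i : Fin 2) : MvPolynomial.pderiv i f ∈ jacobianIdeal f :=
  Ideal.subset_span (by fin_cases i <;> simp)

theorem jacobianIdeal_algEquiv_le (σ : MvPolynomial (Fin 2) k ≃ₐ[k] MvPolynomial (Fin 2) k) :
    jacobianIdeal (σ f) ≤ (jacobianIdeal f).map σ := by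
  rw [jacobianIdeal, Ideal.span_le]
  suffices ∀ i, MvPolynomial.pderiv i (σ f) ∈ (jacobianIdeal f).map σ by
    rintro _ (rfl | rfl) <;> exact this _
  intro i
  have hσ (g) : MvPolynomial.aeval (fun j => σ (.X j)) g = σ g :=
    (DFunLike.congr_fun (MvPolynomial.aeval_unique σ.toAlgHom) g).symm
  rw [← hσ f, derivation_aeval]
  refine sum_mem fun j _ => Ideal.mul_mem_right _ _ ?_
  rw [hσ]
  exact Ideal.mem_map_of_mem _ (pderiv_mem_jacobianIdeal j)

theorem jacobianIdeal_algEquiv (σ : MvPolynomial (Fin 2) k ≃ₐ[k] MvPolynomial (Fin 2) k) :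
    jacobianIdeal (σ f) = (jacobianIdeal f).map σ := by
  refine le_antisymm (jacobianIdeal_algEquiv_le σ) (Ideal.map_le_iff_le_comap.2 ?_)
  have := jacobianIdeal_algEquiv_le (f := σ f) σ.symm
  rw [AlgEquiv.symm_apply_apply] at this
  refine this.trans (Ideal.map_le_iff_le_comap.2 fun g hg => ?_)
  simpa using hg

theorem milnorPencil_algEquiv (σ : MvPolynomial (Fin 2) k ≃ₐ[k] MvPolynomial (Fin 2) k) :
    milnorPencil (σ f) = milnorPencil f := by
  rw [milnorPencil, jacobianIdeal_algEquiv]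
  exact length_quotient_map σ.toRingEquiv _

theorem tjurina_algEquiv (σ : MvPolynomial (Fin 2) k ≃ₐ[k] MvPolynomial (Fin 2) k) :
    tjurina (σ f) = tjurina f := by
  rw [tjurina, jacobianIdeal_algEquiv, ← Set.image_singleton, ← Ideal.map_span, ← Ideal.map_sup]
  exact length_quotient_map σ.toRingEquiv _

theorem span_singleton_C_mul {c : k} (hc : c ≠ 0) :
    Ideal.span {MvPolynomial.C c * f} = Ideal.span {f} :=
  Ideal.span_singleton_mul_left_unit ((IsUnit.mk0 c hc).map _) f

theorem jacobianIdeal_C_mul {c : k} (hc : c ≠ 0) :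
    jacobianIdeal (MvPolynomial.C c * f) = jacobianIdeal f := by
  simp only [jacobianIdeal, MvPolynomial.pderiv_C_mul, Ideal.span_insert, span_singleton_C_mul hc]

theorem milnorPencil_C_mul {c : k} (hc : c ≠ 0) :
    milnorPencil (MvPolynomial.C c * f) = milnorPencil f := by
  rw [milnorPencil, jacobianIdeal_C_mul hc, milnorPencil]

theorem tjurina_C_mul {c : k} (hc : c ≠ 0) : tjurina (MvPolynomial.C c * f) = tjurina f := by
  rw [tjurina, jacobianIdeal_C_mul hc, span_singleton_C_mul hc, tjurina]

end Jacobian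

section DepressedCubic

variable {k : Type*} [Field k] {B D h₀ h₁ : k[X]}

/-- The polynomial `X³ + 3 B(Y) X + D(Y)`, a monic cubic in `X` without quadratic term. The factor
`3` keeps denominators out of its partial derivatives. -/
noncomputable def depressedCubic (B D : k[X]) : MvPolynomial (Fin 2) k :=
  .X 0 ^ 3 + 3 * .X 0 * B.toMvPolynomial 1 + D.toMvPolynomial 1

theorem pderiv_toMvPolynomial {σ : Type*} (i j : σ) (p : k[X]) :
    MvPolynomial.pderiv i (p.toMvPolynomial j) =
      p.derivative.toMvPolynomial j * MvPolynomial.pderiv i (.X j) :=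
  (MvPolynomial.pderiv i).map_aeval p (.X j)

theorem pderiv_zero_depressedCubic : MvPolynomial.pderiv 0 (depressedCubic B D) =
    3 * (.X 0 ^ 2 + B.toMvPolynomial 1) := by
  simp [depressedCubic, pderiv_toMvPolynomial, MvPolynomial.pderiv_X, ← map_ofNat MvPolynomial.C]
  ring

theorem pderiv_one_depressedCubic : MvPolynomial.pderiv 1 (depressedCubic B D) =
    3 * .X 0 * B.derivative.toMvPolynomial 1 + D.derivative.toMvPolynomial 1 := by
  simp [depressedCubic, pderiv_toMvPolynomial, MvPolynomial.pderiv_X, ← map_ofNat MvPolynomial.C]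

theorem exists_of_mem_jacobianIdeal_depressedCubic
    (h : .X 0 * h₁.toMvPolynomial 1 + h₀.toMvPolynomial 1 ∈ jacobianIdeal (depressedCubic B D)) :
    ∃ p q : k[X], h₁ = 3 * p * B.derivative + q * D.derivative ∧
      h₀ = p * D.derivative - 3 * q * B.derivative * B := by
  rw [jacobianIdeal, Ideal.mem_span_pair, pderiv_zero_depressedCubic,
    pderiv_one_depressedCubic] at h
  obtain ⟨P, Q, h⟩ := h
  replace h := congrArg (toPoly 0) h
  simp only [map_add, map_mul, map_pow, map_ofNat, toPoly_X_self,
    toPoly_toMvPolynomial (R := k) (show (1 : Fin 2) ≠ 0 by decide)] at h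
  have hmonic : (X ^ 2 + C B).Monic := monic_X_pow_add_C B two_ne_zero
  have hdeg : (X ^ 2 + C B).natDegree = 2 := natDegree_X_pow_add_C
  obtain ⟨q, p, hqp⟩ := exists_eq_X_add_C_of_natDegree_le_one
    (p := toPoly 0 Q %ₘ (X ^ 2 + C B)) (by
      have := natDegree_modByMonic_lt (toPoly 0 Q) hmonic (fun h => by simp [h] at hdeg)
      omega)
  have hQ := modByMonic_add_div (toPoly 0 Q) (X ^ 2 + C B)
  rw [hqp] at hQ
  have hzero : C (h₁ - (3 * p * B.derivative + q * D.derivative)) * X +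
      C (h₀ - (p * D.derivative - 3 * q * B.derivative * B)) = 0 := by
    refine eq_zero_of_dvd_of_natDegree_lt (p := X ^ 2 + C B) ⟨3 * toPoly 0 P +
      (toPoly 0 Q /ₘ (X ^ 2 + C B)) * (3 * X * C B.derivative + C D.derivative) +
      3 * C (q * B.derivative), ?_⟩ ?_
    · simp only [map_add, map_sub, map_mul, map_ofNat]
      linear_combination -h - (3 * X * C B.derivative + C D.derivative) * hQ
    · rw [hdeg]
      exact natDegree_linear_le.trans_lt one_lt_two
  refine ⟨p, q, sub_eq_zero.1 ?_, sub_eq_zero.1 ?_⟩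
  · simpa using congrArg (coeff · 1) hzero
  · simpa using congrArg (coeff · 0) hzero

theorem natDegree_le_of_eq_mul_add_mul {E G p q : k[X]} {d : ℕ} (hd : d ≠ 0)
    (hB : B.natDegree ≤ d) (hE : E.natDegree ≤ 1) (hG : G.natDegree = d + 1)
    (hh₁ : h₁.natDegree ≤ d + 1) (hh₀ : h₀.natDegree ≤ d + 2) (h1 : h₁ = 3 * p * E + q * G)
    (h0 : h₀ = p * G - 3 * q * E * B) : q.natDegree = 0 ∧ p.natDegree ≤ 1 := by
  have hG0 : G ≠ 0 := ne_zero_of_natDegree_gt (n := d) (by omega)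
  have hq : q.natDegree + (d + 1) ≤ max (d + 1) (p.natDegree + 1) := by
    rcases eq_or_ne q 0 with rfl | h
    · simp
    rw [← hG, ← natDegree_mul h hG0, show q * G = h₁ - C 3 * (p * E) by rw [h1, C_ofNat]; ring, hG]
    refine (natDegree_sub_le _ _).trans (max_le_max hh₁ ?_)
    grw [natDegree_C_mul_le, natDegree_mul_le, hE]
  have hp : p.natDegree + (d + 1) ≤ max (d + 2) (q.natDegree + (1 + d)) := by
    rcases eq_or_ne p 0 with rfl | h
    · simp
    rw [← hG, ← natDegree_mul h hG0,
      show p * G = h₀ + C 3 * (q * (E * B)) by rw [h0, C_ofNat]; ring]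
    refine (natDegree_add_le _ _).trans (max_le_max hh₀ ?_)
    grw [natDegree_C_mul_le, natDegree_mul_le, natDegree_mul_le, hE, hB]
  omega

variable [CharZero k]

variable (k) in
theorem isUnit_ofNat_of_algebra {S : Type*} [CommRing S] [Algebra k S] (n : ℕ) [n.AtLeastTwo] :
    IsUnit (OfNat.ofNat n : S) := by
  rw [← map_ofNat (algebraMap k S)]
  exact (IsUnit.mk0 _ (NeZero.ne _)).map _

theorem finite_quotient_jacobianIdeal_depressedCubic
    (h : D.derivative ^ 2 + 9 * B.derivative ^ 2 * B ≠ 0) :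
    Module.Finite k (MvPolynomial (Fin 2) k ⧸ jacobianIdeal (depressedCubic B D)) := by
  set J := jacobianIdeal (depressedCubic B D)
  set π := Ideal.Quotient.mkₐ k J
  have hπ (i : Fin 2) : π (MvPolynomial.pderiv i (depressedCubic B D)) = 0 :=
    Ideal.Quotient.eq_zero_iff_mem.2 (pderiv_mem_jacobianIdeal i)
  have haeval (p : k[X]) : π (p.toMvPolynomial 1) = aeval (π (.X 1)) p :=
    (Polynomial.aeval_algHom_apply π _ p).symm
  have h0 := hπ 0
  have h1 := hπ 1
  simp only [pderiv_zero_depressedCubic, pderiv_one_depressedCubic, map_add, map_mul, map_pow,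
    map_ofNat, haeval] at h0 h1
  have hy : IsIntegral k (π (.X 1)) := by
    refine IsAlgebraic.isIntegral ⟨_, h, ?_⟩
    simp only [map_add, map_mul, map_pow, map_ofNat]
    linear_combination (aeval (π (.X 1)) D.derivative -
      3 * π (.X 0) * aeval (π (.X 1)) B.derivative) * h1 +
      3 * aeval (π (.X 1)) B.derivative ^ 2 * h0
  have hx : IsIntegral k (π (.X 0)) := by
    refine .of_pow two_pos ?_
    rw [eq_neg_of_add_eq_zero_left ((isUnit_ofNat_of_algebra k 3).mul_right_eq_zero.1 h0)]
    exact (adjoin_le_integralClosure hy (aeval_mem_adjoin_singleton k _)).neg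
  have : Algebra.IsIntegral k (MvPolynomial (Fin 2) k ⧸ J) := by
    refine ⟨fun z => ?_⟩
    obtain ⟨p, rfl⟩ := Ideal.Quotient.mk_surjective z
    induction p using MvPolynomial.induction_on with
    | C r => exact isIntegral_algebraMap (x := r)
    | add p q hp hq => rw [map_add]; exact hp.add hq
    | mul_X p i hp =>
      rw [map_mul]
      refine hp.mul ?_
      fin_cases i
      exacts [hx, hy]
  exact Algebra.IsIntegral.finite

theorem X_sq_add_mem_jacobianIdeal_depressedCubic :
    .X 0 ^ 2 + B.toMvPolynomial 1 ∈ jacobianIdeal (depressedCubic B D) := by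
  have h := pderiv_mem_jacobianIdeal (f := depressedCubic B D) 0
  rwa [pderiv_zero_depressedCubic,
    Ideal.unit_mul_mem_iff_mem _ (isUnit_ofNat_of_algebra k 3)] at h

theorem milnorPencil_depressedCubic_ne_top
    (h : D.derivative ^ 2 + 9 * B.derivative ^ 2 * B ≠ 0) :
    milnorPencil (depressedCubic B D) ≠ ⊤ := by
  have := finite_quotient_jacobianIdeal_depressedCubic h
  have := isArtinian_of_tower (M := MvPolynomial (Fin 2) k ⧸ jacobianIdeal (depressedCubic B D))
    k (S := MvPolynomial (Fin 2) k) inferInstance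
  have := isNoetherian_of_tower (M := MvPolynomial (Fin 2) k ⧸ jacobianIdeal (depressedCubic B D))
    k (S := MvPolynomial (Fin 2) k) inferInstance
  exact Module.length_ne_top

/-- The difference of `4 f` and `4 X f_X / 3 + Y f_Y` for `f = X³ + 3 B(Y) X + D(Y)`. The weights
`4` and `3` of `X` and `Y` make `X³ + Y⁴` homogeneous, so these two terms cancel. -/
noncomputable def eulerDefect (B D : k[X]) : MvPolynomial (Fin 2) k :=
  .X 0 * (8 * B - 3 * X * B.derivative).toMvPolynomial 1 +
    (4 * D - X * D.derivative).toMvPolynomial 1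

theorem mul_eulerDefect_mem_iff {p : MvPolynomial (Fin 2) k} :
    p * eulerDefect B D ∈ jacobianIdeal (depressedCubic B D) ↔
      p * depressedCubic B D ∈ jacobianIdeal (depressedCubic B D) := by
  have heuler : 12 * (p * depressedCubic B D) = 3 * (p * eulerDefect B D) +
      p * (4 * .X 0 * MvPolynomial.pderiv 0 (depressedCubic B D) +
        3 * .X 1 * MvPolynomial.pderiv 1 (depressedCubic B D)) := by
    rw [pderiv_zero_depressedCubic, pderiv_one_depressedCubic, depressedCubic, eulerDefect]
    simp only [map_sub, map_mul, map_ofNat, toMvPolynomial_X]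
    ring
  rw [← Ideal.unit_mul_mem_iff_mem _ (y := 12) (isUnit_ofNat_of_algebra k 12)
    (x := p * depressedCubic B D), heuler, Ideal.add_mem_iff_left,
    Ideal.unit_mul_mem_iff_mem _ (isUnit_ofNat_of_algebra k 3)]
  exact Ideal.mul_mem_left _ _ (add_mem (Ideal.mul_mem_left _ _ (pderiv_mem_jacobianIdeal 0))
    (Ideal.mul_mem_left _ _ (pderiv_mem_jacobianIdeal 1)))

end DepressedCubic

section Unfolding

variable {k : Type*} [Field k] {a b c d e g α β : k}

/-- The curve `X³ + 3 (a Y² + b Y + c) X + Y⁴ + d Y² + e Y + g`. These curves form the miniversal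
unfolding of the `E₆` singularity `X³ + Y⁴`. -/
noncomputable def unfolding (a b c d e g : k) : MvPolynomial (Fin 2) k :=
  depressedCubic (C a * X ^ 2 + C b * X + C c) (X ^ 4 + C d * X ^ 2 + C e * X + C g)

theorem quartic_eq_zero_iff {s₄ s₃ s₂ s₁ s₀ : k} :
    C s₄ * X ^ 4 + C s₃ * X ^ 3 + C s₂ * X ^ 2 + C s₁ * X + C s₀ = 0 ↔
      s₄ = 0 ∧ s₃ = 0 ∧ s₂ = 0 ∧ s₁ = 0 ∧ s₀ = 0 := by
  refine ⟨fun h => ?_, by rintro ⟨rfl, rfl, rfl, rfl, rfl⟩; simp⟩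
  refine ⟨?_, ?_, ?_, ?_, ?_⟩
  · simpa [coeff_X, coeff_C] using congrArg (coeff · 4) h
  · simpa [coeff_X, coeff_C] using congrArg (coeff · 3) h
  · simpa [coeff_X, coeff_C] using congrArg (coeff · 2) h
  · simpa [coeff_X, coeff_C] using congrArg (coeff · 1) h
  · simpa [coeff_X, coeff_C] using congrArg (coeff · 0) h

theorem derivative_quadratic :
    derivative (C a * X ^ 2 + C b * X + C c) = 2 * C a * X + C b := by
  simp only [derivative_add, derivative_C_mul, derivative_X_pow, derivative_X, derivative_C,
    Nat.cast_ofNat, map_ofNat, Nat.reduceSub]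
  ring

theorem derivative_depressed_quartic : derivative (X ^ 4 + C d * X ^ 2 + C e * X + C g) =
    4 * X ^ 3 + 2 * C d * X + C e := by
  simp only [derivative_add, derivative_C_mul, derivative_X_pow, derivative_X, derivative_C,
    Nat.cast_ofNat, map_ofNat, Nat.reduceSub]
  ring

theorem eulerDefect_unfolding :
    eulerDefect (C a * X ^ 2 + C b * X + C c) (X ^ 4 + C d * X ^ 2 + C e * X + C g) =
      .X 0 * (C (2 * a) * X ^ 2 + C (5 * b) * X + C (8 * c)).toMvPolynomial 1 +
      (C (2 * d) * X ^ 2 + C (3 * e) * X + C (4 * g)).toMvPolynomial 1 := by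
  rw [eulerDefect, derivative_quadratic, derivative_depressed_quartic]
  congr 3 <;> simp only [map_ofNat, map_mul] <;> ring

variable [CharZero k]

theorem exists_of_mem_jacobianIdeal_unfolding {h₁ h₀ : k[X]} (hh₁ : h₁.natDegree ≤ 3)
    (hh₀ : h₀.natDegree ≤ 4) (h : .X 0 * h₁.toMvPolynomial 1 + h₀.toMvPolynomial 1 ∈
      jacobianIdeal (unfolding a b c d e g)) :
    ∃ q p₁ p₀ : k,
      h₁ = 3 * (C p₁ * X + C p₀) * (2 * C a * X + C b) + C q * (4 * X ^ 3 + 2 * C d * X + C e) ∧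
      h₀ = (C p₁ * X + C p₀) * (4 * X ^ 3 + 2 * C d * X + C e) -
        3 * C q * (2 * C a * X + C b) * (C a * X ^ 2 + C b * X + C c) := by
  obtain ⟨p, q, h1, h0⟩ := exists_of_mem_jacobianIdeal_depressedCubic h
  rw [derivative_quadratic, derivative_depressed_quartic] at h1 h0
  have hD' : (4 * X ^ 3 + 2 * C d * X + C e).natDegree = 3 := by
    rw [← C_ofNat, ← C_ofNat, ← C_mul]
    compute_degree!
  have hB' : (2 * C a * X + C b).natDegree ≤ 1 := by
    rw [← C_ofNat, ← C_mul]
    exact natDegree_linear_le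
  obtain ⟨hq, hp⟩ := natDegree_le_of_eq_mul_add_mul two_ne_zero natDegree_quadratic_le hB' hD' hh₁
    hh₀ h1 h0
  obtain ⟨p₁, p₀, rfl⟩ := exists_eq_X_add_C_of_natDegree_le_one hp
  rw [eq_C_of_natDegree_eq_zero hq] at h1 h0
  exact ⟨_, p₁, p₀, h1, h0⟩

theorem mul_unfolding_mem_iff {p : MvPolynomial (Fin 2) k} :
    p * unfolding a b c d e g ∈ jacobianIdeal (unfolding a b c d e g) ↔
      p * (.X 0 * (C (2 * a) * X ^ 2 + C (5 * b) * X + C (8 * c)).toMvPolynomial 1 +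
        (C (2 * d) * X ^ 2 + C (3 * e) * X + C (4 * g)).toMvPolynomial 1) ∈
      jacobianIdeal (unfolding a b c d e g) := by
  rw [← eulerDefect_unfolding, unfolding, mul_eulerDefect_mem_iff]

theorem relations_of_X_one_sub_C_mul_mem
    (h : (.X 1 - .C β) * unfolding a b c d e g ∈ jacobianIdeal (unfolding a b c d e g)) :
    5 * b = 2 * a * β ∧ 16 * c = 10 * b * β + 8 * a * d + 9 * a ^ 4 ∧
      -32 * c * β = 3 * b * (2 * d + 3 * a ^ 3) + 2 * a * e := by
  rw [mul_unfolding_mem_iff] at h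
  obtain ⟨q, p₁, p₀, h1, h0⟩ := exists_of_mem_jacobianIdeal_unfolding (a := a) (b := b) (c := c)
    (d := d) (e := e) (g := g)
    (h₁ := (X - C β) * (C (2 * a) * X ^ 2 + C (5 * b) * X + C (8 * c)))
    (h₀ := (X - C β) * (C (2 * d) * X ^ 2 + C (3 * e) * X + C (4 * g))) (by compute_degree!)
    (by compute_degree!) (by
      convert h using 1
      simp only [map_mul, map_sub, toMvPolynomial_X, toMvPolynomial_C]
      ring)
  obtain ⟨-, hq, h12, h11, h10⟩ := quartic_eq_zero_iff (s₄ := 0) (s₃ := 2 * a - 4 * q)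
    (s₂ := 5 * b - 2 * a * β - 6 * p₁ * a)
    (s₁ := 8 * c - 5 * b * β - (3 * p₁ * b + 6 * p₀ * a + 2 * q * d))
    (s₀ := -8 * c * β - (3 * p₀ * b + q * e)) |>.1 (by
      simp only [map_sub, map_add, map_mul, map_neg, map_ofNat, map_zero] at h1 ⊢
      linear_combination h1)
  obtain ⟨hp₁, hp₀, -⟩ := quartic_eq_zero_iff (s₄ := -4 * p₁)
    (s₃ := 2 * d - 4 * p₀ + 6 * q * a ^ 2)
    (s₂ := 3 * e - 2 * d * β - 2 * p₁ * d + 9 * q * a * b)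
    (s₁ := 4 * g - 3 * e * β - (p₁ * e + 2 * p₀ * d) + 3 * q * (2 * a * c + b ^ 2))
    (s₀ := -4 * g * β - p₀ * e + 3 * q * b * c) |>.1 (by
      simp only [map_sub, map_add, map_mul, map_neg, map_ofNat, map_pow] at h0 ⊢
      linear_combination h0)
  obtain rfl : p₁ = 0 := by simpa using hp₁
  obtain rfl : q = a / 2 := by linear_combination -hq / 4
  obtain rfl : p₀ = (2 * d + 3 * a ^ 3) / 4 := by linear_combination -hp₀ / 4
  exact ⟨by linear_combination h12, by linear_combination 2 * h11, by linear_combination 4 * h10⟩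

theorem relations_of_X_zero_sub_C_mul_mem
    (h : (.X 0 - .C α) * unfolding a b c d e g ∈ jacobianIdeal (unfolding a b c d e g)) :
    2 * d = 2 * a * α - 3 * a ^ 3 ∧ 3 * e = 5 * b * α - 12 * a ^ 2 * b ∧
      16 * g = 32 * c * α - 21 * a * b ^ 2 ∧
      10 * a * c + 5 * b ^ 2 + 2 * d * α = a ^ 2 * d := by
  have hmem := sub_mem (mul_unfolding_mem_iff.1 h) (Ideal.mul_mem_left _
    (toMvPolynomial 1 (C (2 * a) * X ^ 2 + C (5 * b) * X + C (8 * c)))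
    (X_sq_add_mem_jacobianIdeal_depressedCubic (B := C a * X ^ 2 + C b * X + C c)
      (D := X ^ 4 + C d * X ^ 2 + C e * X + C g)))
  obtain ⟨q, p₁, p₀, h1, h0⟩ := exists_of_mem_jacobianIdeal_unfolding (a := a) (b := b) (c := c)
    (d := d) (e := e) (g := g)
    (h₁ := C (2 * d) * X ^ 2 + C (3 * e) * X + C (4 * g) -
      C α * (C (2 * a) * X ^ 2 + C (5 * b) * X + C (8 * c)))
    (h₀ := -((C a * X ^ 2 + C b * X + C c) * (C (2 * a) * X ^ 2 + C (5 * b) * X + C (8 * c)) +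
      C α * (C (2 * d) * X ^ 2 + C (3 * e) * X + C (4 * g)))) (by compute_degree!)
    (by compute_degree!) (by
      convert hmem using 1
      simp only [map_neg, map_add, map_sub, map_mul, toMvPolynomial_C]
      ring)
  obtain ⟨-, hq, h12, h11, h10⟩ := quartic_eq_zero_iff (s₄ := 0) (s₃ := -4 * q)
    (s₂ := 2 * d - 2 * a * α - 6 * p₁ * a)
    (s₁ := 3 * e - 5 * b * α - (3 * p₁ * b + 6 * p₀ * a + 2 * q * d))
    (s₀ := 4 * g - 8 * c * α - (3 * p₀ * b + q * e)) |>.1 (by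
      simp only [map_sub, map_add, map_mul, map_neg, map_ofNat, map_zero] at h1 ⊢
      linear_combination h1)
  obtain ⟨hp₁, hp₀, h02, -⟩ := quartic_eq_zero_iff (s₄ := -2 * a ^ 2 - 4 * p₁)
    (s₃ := -7 * a * b - 4 * p₀ + 6 * q * a ^ 2)
    (s₂ := -10 * a * c - 5 * b ^ 2 - 2 * d * α - 2 * p₁ * d + 9 * q * a * b)
    (s₁ := -13 * b * c - 3 * e * α - (p₁ * e + 2 * p₀ * d) + 3 * q * (2 * a * c + b ^ 2))
    (s₀ := -8 * c ^ 2 - 4 * g * α - p₀ * e + 3 * q * b * c) |>.1 (by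
      simp only [map_sub, map_add, map_mul, map_neg, map_ofNat, map_pow] at h0 ⊢
      linear_combination h0)
  obtain rfl : q = 0 := by simpa using hq
  obtain rfl : p₁ = -a ^ 2 / 2 := by linear_combination -hp₁ / 4
  obtain rfl : p₀ = -7 * a * b / 4 := by linear_combination -hp₀ / 4
  exact ⟨by linear_combination h12, by linear_combination h11, by linear_combination 4 * h10,
    by linear_combination -h02⟩

theorem parameters_of_X_sub_C_mul_mem
    (hα : (.X 0 - .C α) * unfolding a b c d e g ∈ jacobianIdeal (unfolding a b c d e g))
    (hβ : (.X 1 - .C β) * unfolding a b c d e g ∈ jacobianIdeal (unfolding a b c d e g)) :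
    (b = 2 / 5 * a * β ∧ c = a * β ^ 2 / 4 + a ^ 2 * α / 2 - 3 / 16 * a ^ 4 ∧
      d = a * α - 3 / 2 * a ^ 3 ∧ e = 2 / 3 * a * α * β - 8 / 5 * a ^ 3 * β ∧
      g = 2 * c * α - 21 / 100 * a ^ 3 * β ^ 2) ∧
    a * β * (60 * β ^ 2 + 148 * a * α - 69 * a ^ 3) = 0 ∧
    a * (16 * α ^ 2 + 8 * a ^ 2 * α - 3 * a ^ 4) = -(132 / 5 * a ^ 2 * β ^ 2) := by
  obtain ⟨h1, h2, h3⟩ := relations_of_X_one_sub_C_mul_mem hβ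
  obtain ⟨h4, h5, h6, h7⟩ := relations_of_X_zero_sub_C_mul_mem hα
  obtain rfl : b = 2 / 5 * a * β := by linear_combination h1 / 5
  obtain rfl : d = a * α - 3 / 2 * a ^ 3 := by linear_combination h4 / 2
  obtain rfl : e = 2 / 3 * a * α * β - 8 / 5 * a ^ 3 * β := by linear_combination h5 / 3
  obtain rfl : c = a * β ^ 2 / 4 + a ^ 2 * α / 2 - 3 / 16 * a ^ 4 := by linear_combination h2 / 16
  refine ⟨⟨rfl, rfl, rfl, rfl, by linear_combination h6 / 16⟩, ?_, ?_⟩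
  · linear_combination -15 / 2 * h3
  · linear_combination 8 * h7

omit [CharZero k] in
theorem exists_sq_eq_cube_eq (ha : a ≠ 0) {m n : k} (hm : m ≠ 0) (hn : n ≠ 0)
    (h : m ^ 3 * β ^ 2 = n ^ 2 * a ^ 3) : ∃ s ≠ 0, a = m * s ^ 2 ∧ β = n * s ^ 3 := by
  refine ⟨m * β / (n * a), ?_, ?_, ?_⟩
  · rintro h0
    have : β = 0 := by simpa [hm, hn, ha] using h0
    simp [this, hn, ha] at h
  · field_simp
    linear_combination -h
  · field_simp
    linear_combination -β * h

theorem exists_parameters_eq [IsAlgClosed k] (ha : a ≠ 0)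
    (hr : a * β * (60 * β ^ 2 + 148 * a * α - 69 * a ^ 3) = 0)
    (hs : a * (16 * α ^ 2 + 8 * a ^ 2 * α - 3 * a ^ 4) = -(132 / 5 * a ^ 2 * β ^ 2)) :
    ∃ s ≠ 0, (a = -2 * s ^ 2 ∧ α = s ^ 4 ∧ β = 0) ∨ (a = 6 * s ^ 2 ∧ α = -27 * s ^ 4 ∧ β = 0) ∨
      (a = -4 * s ^ 2 ∧ α = 48 * s ^ 4 ∧ β = -20 * s ^ 3) ∨
      (a = -10 * s ^ 2 ∧ α = 57 * s ^ 4 ∧ β = -16 * s ^ 3) := by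
  have hsqrt (m : k) (hm : m ≠ 0) : ∃ s ≠ 0, a = m * s ^ 2 := by
    obtain ⟨s, hs⟩ := IsAlgClosed.exists_pow_nat_eq (a / m) two_pos
    refine ⟨s, ?_, by rw [hs, mul_div_cancel₀ _ hm]⟩
    rintro rfl
    exact div_ne_zero ha hm (by rw [← hs, zero_pow two_ne_zero])
  rcases eq_or_ne β 0 with rfl | hβ
  · have hfac : (4 * α - a ^ 2) * (4 * α + 3 * a ^ 2) = 0 :=
      (mul_eq_zero_iff_left ha).1 (by linear_combination hs)
    rcases mul_eq_zero.1 hfac with h | h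
    · obtain ⟨s, hs0, rfl⟩ := hsqrt (-2) (by norm_num)
      exact ⟨s, hs0, .inl ⟨rfl, by linear_combination h / 4, rfl⟩⟩
    · obtain ⟨s, hs0, rfl⟩ := hsqrt 6 (by norm_num)
      exact ⟨s, hs0, .inr (.inl ⟨rfl, by linear_combination h / 4, rfl⟩)⟩
  · have hrβ := (mul_eq_zero_iff_left (mul_ne_zero ha hβ)).1 hr
    have hfac : (α - 3 * a ^ 2) * (100 * α - 57 * a ^ 2) = 0 :=
      (mul_eq_zero_iff_left ha).1 (by linear_combination 25 / 4 * hs - 11 / 4 * a ^ 2 * hrβ)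
    rcases mul_eq_zero.1 hfac with h | h
    · obtain ⟨s, hs0, rfl, rfl⟩ := exists_sq_eq_cube_eq (m := -4) (n := -20) (β := β) ha
        (by norm_num) (by norm_num) (by linear_combination -16 / 15 * hrβ + 2368 / 15 * a * h)
      exact ⟨s, hs0, .inr (.inr (.inl ⟨rfl, by linear_combination h, rfl⟩))⟩
    · obtain ⟨s, hs0, rfl, rfl⟩ := exists_sq_eq_cube_eq (m := -10) (n := -16) (β := β) ha
        (by norm_num) (by norm_num) (by linear_combination -50 / 3 * hrβ + 74 / 3 * a * h)
      exact ⟨s, hs0, .inr (.inr (.inr ⟨rfl, by linear_combination h / 100, rfl⟩))⟩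

theorem unfolding_zero_mem_jacobianIdeal :
    unfolding (0 : k) 0 0 0 0 0 ∈ jacobianIdeal (unfolding 0 0 0 0 0 0) := by
  simpa using (mul_unfolding_mem_iff (p := 1) (a := (0 : k)) (b := 0) (c := 0) (d := 0) (e := 0)
    (g := 0)).2 (by simp)

theorem milnorPencil_unfolding_ne_top : milnorPencil (unfolding a b c d e g) ≠ ⊤ := by
  suffices hdeg : (derivative (X ^ 4 + C d * X ^ 2 + C e * X + C g) ^ 2 + 9 *
      derivative (C a * X ^ 2 + C b * X + C c) ^ 2 * (C a * X ^ 2 + C b * X + C c)).natDegree = 6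
    from milnorPencil_depressedCubic_ne_top (ne_zero_of_natDegree_gt (n := 5) (by omega))
  rw [derivative_quadratic, derivative_depressed_quartic]
  simp only [← C_ofNat, ← C_mul]
  compute_degree!

theorem unfolding_eq_of_milnorPencil_eq [IsAlgClosed k]
    (h : milnorPencil (unfolding a b c d e g) = tjurina (unfolding a b c d e g) + 1) :
    ∃ s ≠ 0,
      unfolding a b c d e g =
        unfolding (-2 * s ^ 2) 0 (-s ^ 8) (10 * s ^ 6) 0 (-2 * s ^ 12) ∨
      unfolding a b c d e g =
        unfolding (6 * s ^ 2) 0 (-729 * s ^ 8) (-486 * s ^ 6) 0 (39366 * s ^ 12) ∨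
      unfolding a b c d e g = unfolding (-4 * s ^ 2) (32 * s ^ 5) (-64 * s ^ 8) (-96 * s ^ 6)
        (512 * s ^ 9) (-768 * s ^ 12) ∨
      unfolding a b c d e g = unfolding (-10 * s ^ 2) (64 * s ^ 5) (335 * s ^ 8) (930 * s ^ 6)
        (-19520 * s ^ 9) (91950 * s ^ 12) := by
  have hmax := isMaximal_colon_of_length_quotient milnorPencil_unfolding_ne_top h
  obtain ⟨p, hp⟩ := exists_forall_sub_eval_mul_mem hmax
  have hmem : unfolding a b c d e g ∉ jacobianIdeal (unfolding a b c d e g) := fun hmem =>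
    hmax.ne_top ((Ideal.eq_top_iff_one _).2 (Submodule.mem_colon_singleton.2 (by simpa using hmem)))
  obtain ⟨⟨rfl, rfl, rfl, rfl, rfl⟩, hr, hs⟩ := parameters_of_X_sub_C_mul_mem
    (by simpa using hp (.X 0)) (by simpa using hp (.X 1))
  have ha : a ≠ 0 := by
    rintro rfl
    exact hmem (by simpa using unfolding_zero_mem_jacobianIdeal (k := k))
  obtain ⟨s, hs0, ⟨rfl, hα, hβ⟩ | ⟨rfl, hα, hβ⟩ | ⟨rfl, hα, hβ⟩ | ⟨rfl, hα, hβ⟩⟩ :=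
    exists_parameters_eq ha hr hs
  · exact ⟨s, hs0, .inl (by rw [hα, hβ]; congr! 1 <;> ring)⟩
  · exact ⟨s, hs0, .inr (.inl (by rw [hα, hβ]; congr! 1 <;> ring))⟩
  · exact ⟨s, hs0, .inr (.inr (.inl (by rw [hα, hβ]; congr! 1 <;> ring)))⟩
  · exact ⟨s, hs0, .inr (.inr (.inr (by rw [hα, hβ]; congr! 1 <;> ring)))⟩

end Unfolding

section TriangularEquiv

variable {k : Type*} [Field k]

/-- The triangular automorphism `X ↦ l X + A(Y)`, `Y ↦ m Y + r` of the plane. -/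
noncomputable def triangularEquiv (l m : kˣ) (A : k[X]) (r : k) :
    MvPolynomial (Fin 2) k ≃ₐ[k] MvPolynomial (Fin 2) k :=
  AlgEquiv.ofAlgHom
    (MvPolynomial.aeval ![(l : k) • .X 0 + A.toMvPolynomial 1, (m : k) • .X 1 + .C r])
    (MvPolynomial.aeval
      ![(l⁻¹ : k) • (.X 0 - (A.comp ((m⁻¹ : k) • (X - C r))).toMvPolynomial 1),
        (m⁻¹ : k) • (.X 1 - .C r)])
    (by
      refine MvPolynomial.algHom_ext fun i => ?_
      fin_cases i <;>
        simp [MvPolynomial.algHom_C, toMvPolynomial, ← Polynomial.aeval_algHom_apply, aeval_comp])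
    (by
      refine MvPolynomial.algHom_ext fun i => ?_
      fin_cases i <;>
        simp [MvPolynomial.algHom_C, toMvPolynomial, ← Polynomial.aeval_algHom_apply, aeval_comp])

variable {l m : kˣ} {A : k[X]} {r : k}

theorem triangularEquiv_X_zero :
    triangularEquiv l m A r (.X 0) = .C (l : k) * .X 0 + A.toMvPolynomial 1 := by
  simp [triangularEquiv, MvPolynomial.smul_eq_C_mul]

theorem triangularEquiv_X_one : triangularEquiv l m A r (.X 1) = .C (m : k) * .X 1 + .C r := by
  simp [triangularEquiv, MvPolynomial.smul_eq_C_mul]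

theorem triangularEquiv_C (c : k) : triangularEquiv l m A r (.C c) = .C c :=
  (triangularEquiv l m A r).commutes c

theorem triangularEquiv_toMvPolynomial (p : k[X]) :
    triangularEquiv l m A r (p.toMvPolynomial 1) =
      (p.comp (C (m : k) * X + C r)).toMvPolynomial 1 := by
  simp only [toMvPolynomial, ← Polynomial.aeval_algHom_apply, aeval_comp, triangularEquiv_X_one]
  simp

end TriangularEquiv

section NormalForm

variable {k : Type*} [Field k] {f : MvPolynomial (Fin 2) k} {B D : k[X]}

theorem eq_of_natDegree_le_two {p : k[X]} (hp : p.natDegree ≤ 2) :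
    p = C (p.coeff 2) * X ^ 2 + C (p.coeff 1) * X + C (p.coeff 0) := by
  conv_lhs => rw [p.as_sum_range_C_mul_X_pow' (Nat.lt_succ_of_le hp)]
  simp only [Finset.sum_range_succ, Finset.sum_range_zero]
  ring

theorem eq_of_natDegree_le_four {p : k[X]} (hp : p.natDegree ≤ 4) :
    p = C (p.coeff 4) * X ^ 4 + C (p.coeff 3) * X ^ 3 + C (p.coeff 2) * X ^ 2 +
      C (p.coeff 1) * X + C (p.coeff 0) := by
  conv_lhs => rw [p.as_sum_range_C_mul_X_pow' (Nat.lt_succ_of_le hp)]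
  simp only [Finset.sum_range_succ, Finset.sum_range_zero]
  ring

theorem eq_sum_coeff_toPoly {i j : Fin 2} (h : j ≠ i) :
    f = ∑ n ∈ Finset.range (f.degreeOf i + 1),
      ((toPoly i f).coeff n).toMvPolynomial j * .X i ^ n := by
  apply (toPoly i).injective
  conv_lhs => rw [(toPoly i f).as_sum_range_C_mul_X_pow, natDegree_toPoly]
  simp only [map_sum, map_mul, map_pow, toPoly_X_self, toPoly_toMvPolynomial h]

theorem natDegree_coeff_toPoly_le {i j : Fin 2} (h : j ≠ i) {n N : ℕ}
    (hf : ∀ d ∈ f.support, d i = n → d j ≤ N) : ((toPoly i f).coeff n).natDegree ≤ N := by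
  refine natDegree_le_iff_coeff_eq_zero.2 fun b hb => ?_
  rw [coeff_toPoly h]
  by_contra hne
  have := hf _ (MvPolynomial.mem_support_iff.2 hne) (by simp [h])
  simp [h.symm] at this
  omega

theorem C_mul_triangularEquiv_cubic {c u : k} {l : kˣ} (h : u * c * l ^ 3 = 1) (E F D : k[X]) :
    .C u * triangularEquiv l 1 (-E) 0 (.C c * (.X 0 ^ 3 + 3 * .X 0 ^ 2 * E.toMvPolynomial 1 +
        3 * .X 0 * F.toMvPolynomial 1) + D.toMvPolynomial 1) =
      depressedCubic (C (u * c * l) * (F - E ^ 2))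
        (C (u * c) * (2 * E ^ 3 - 3 * E * F) + C u * D) := by
  replace h := congrArg (MvPolynomial.C (σ := Fin 2)) h
  simp only [depressedCubic, map_add, map_sub, map_neg, map_mul, map_pow, map_ofNat, map_one,
    map_zero, Units.val_one, triangularEquiv_X_zero, triangularEquiv_toMvPolynomial,
    triangularEquiv_C, one_mul, add_zero, comp_X, toMvPolynomial_C] at h ⊢
  linear_combination .X 0 ^ 3 * h

theorem exists_eq_cubic [CharZero k] (hX : f.degreeOf 0 = 3)
    (h : ∀ d ∈ f.support, 4 * d 0 + 3 * d 1 ≤ 12) (h3 : f.coeff (Finsupp.single 0 3) ≠ 0) :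
    ∃ E F D : k[X], E.natDegree ≤ 1 ∧ F.natDegree ≤ 2 ∧ D.natDegree ≤ 4 ∧
      D.coeff 4 = f.coeff (Finsupp.single 1 4) ∧
      f = .C (f.coeff (Finsupp.single 0 3)) * (.X 0 ^ 3 + 3 * .X 0 ^ 2 * E.toMvPolynomial 1 +
        3 * .X 0 * F.toMvPolynomial 1) + D.toMvPolynomial 1 := by
  have h10 : (1 : Fin 2) ≠ 0 := by decide
  have hdeg (n N : ℕ) (hn : 12 < 4 * n + 3 * (N + 1)) : ((toPoly 0 f).coeff n).natDegree ≤ N :=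
    natDegree_coeff_toPoly_le h10 fun d hd hdn => by have := h d hd; omega
  set c := f.coeff (Finsupp.single 0 3)
  have hcoeff : (toPoly 0 f).coeff 3 = C c := by
    rw [eq_C_of_natDegree_le_zero (hdeg 3 0 (by norm_num)), coeff_toPoly h10,
      Finsupp.single_zero, add_zero]
  have hc' : MvPolynomial.C (σ := Fin 2) c * (3 * .C (3 * c)⁻¹) = 1 := by
    rw [← map_ofNat MvPolynomial.C, ← map_mul, ← map_mul, ← map_one MvPolynomial.C]
    congr 1
    field_simp
  refine ⟨C (3 * c)⁻¹ * (toPoly 0 f).coeff 2, C (3 * c)⁻¹ * (toPoly 0 f).coeff 1,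
    (toPoly 0 f).coeff 0, (natDegree_C_mul_le _ _).trans (hdeg 2 1 (by norm_num)),
    (natDegree_C_mul_le _ _).trans (hdeg 1 2 (by norm_num)), hdeg 0 4 (by norm_num),
    by rw [coeff_toPoly h10, Finsupp.single_zero, zero_add], ?_⟩
  conv_lhs => rw [eq_sum_coeff_toPoly (f := f) h10, hX]
  simp only [Finset.sum_range_succ, Finset.sum_range_zero, hcoeff, map_mul, toMvPolynomial_C]
  linear_combination -(.X 0 ^ 2 * ((toPoly 0 f).coeff 2).toMvPolynomial 1 +
    .X 0 * ((toPoly 0 f).coeff 1).toMvPolynomial 1) * hc'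

theorem exists_algEquiv_eq_depressedCubic [IsAlgClosed k] {c : k} (hc : c ≠ 0) {E F D : k[X]}
    (hE : E.natDegree ≤ 1) (hF : F.natDegree ≤ 2) (hD : D.natDegree ≤ 4) (hD4 : D.coeff 4 ≠ 0) :
    ∃ (σ : MvPolynomial (Fin 2) k ≃ₐ[k] MvPolynomial (Fin 2) k) (u : k) (B D' : k[X]),
      u ≠ 0 ∧ B.natDegree ≤ 2 ∧ D'.natDegree ≤ 4 ∧ D'.coeff 4 = 1 ∧
        .C u * σ (.C c * (.X 0 ^ 3 + 3 * .X 0 ^ 2 * E.toMvPolynomial 1 +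
          3 * .X 0 * F.toMvPolynomial 1) + D.toMvPolynomial 1) = depressedCubic B D' := by
  obtain ⟨l, hl⟩ := IsAlgClosed.exists_pow_nat_eq ((D.coeff 4)⁻¹ * c)⁻¹ three_pos
  have huc : (D.coeff 4)⁻¹ * c ≠ 0 := mul_ne_zero (inv_ne_zero hD4) hc
  have hl0 : l ≠ 0 := by
    rintro rfl
    exact inv_ne_zero huc (by rw [← hl, zero_pow three_ne_zero])
  have hEF : (C ((D.coeff 4)⁻¹ * c) * (2 * E ^ 3 - 3 * E * F)).natDegree ≤ 3 :=
    (natDegree_C_mul_le _ _).trans (natDegree_sub_le_of_le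
      (natDegree_mul_le_of_le (natDegree_ofNat 2).le (natDegree_pow_le_of_le 3 hE))
      (natDegree_mul_le_of_le (natDegree_mul_le_of_le (natDegree_ofNat 3).le hE) hF))
  refine ⟨triangularEquiv (.mk0 l hl0) 1 (-E) 0, (D.coeff 4)⁻¹, _, _, inv_ne_zero hD4, ?_, ?_, ?_,
    C_mul_triangularEquiv_cubic (by rw [Units.val_mk0, hl, mul_inv_cancel₀ huc]) E F D⟩
  · exact (natDegree_C_mul_le _ _).trans (natDegree_sub_le_of_le hF (natDegree_pow_le_of_le 2 hE))
  · exact natDegree_add_le_of_le (hEF.trans (Nat.le_succ 3)) ((natDegree_C_mul_le _ _).trans hD)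
  · rw [coeff_add, coeff_eq_zero_of_natDegree_lt (hEF.trans_lt (by norm_num)), coeff_C_mul,
      inv_mul_cancel₀ hD4, zero_add]

theorem exists_algEquiv_eq_unfolding [CharZero k] (hB : B.natDegree ≤ 2)
    (hD : D.natDegree ≤ 4) (hD4 : D.coeff 4 = 1) :
    ∃ (σ : MvPolynomial (Fin 2) k ≃ₐ[k] MvPolynomial (Fin 2) k) (a b c d e g : k),
      σ (depressedCubic B D) = unfolding a b c d e g := by
  obtain ⟨b₂, b₁, b₀, rfl⟩ : ∃ b₂ b₁ b₀, B = C b₂ * X ^ 2 + C b₁ * X + C b₀ :=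
    ⟨_, _, _, eq_of_natDegree_le_two hB⟩
  obtain ⟨r, q, s, t, rfl⟩ : ∃ r q s t, D = X ^ 4 + 4 * C r * X ^ 3 + C q * X ^ 2 + C s * X + C t :=
    ⟨D.coeff 3 / 4, _, _, _, by
      conv_lhs => rw [eq_of_natDegree_le_four hD, hD4, C_1, one_mul]
      rw [← C_ofNat, ← C_mul, mul_div_cancel₀ _ (OfNat.ofNat_ne_zero 4)]⟩
  refine ⟨triangularEquiv 1 1 0 (-r), b₂, b₁ - 2 * b₂ * r, b₂ * r ^ 2 - b₁ * r + b₀, q - 6 * r ^ 2,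
    8 * r ^ 3 - 2 * q * r + s, q * r ^ 2 - 3 * r ^ 4 - s * r + t, ?_⟩
  simp only [unfolding, depressedCubic, map_add, map_sub, map_mul, map_pow, map_neg, map_ofNat,
    map_zero, map_one, triangularEquiv_X_zero, triangularEquiv_X_one, triangularEquiv_C,
    Units.val_one, toMvPolynomial_C, toMvPolynomial_X]
  ring

theorem IsSituationTwo.exists_algEquiv_eq_unfolding [IsAlgClosed k] [CharZero k]
    [Fact (Irreducible f)] (h : IsSituationTwo f) :
    ∃ (σ : MvPolynomial (Fin 2) k ≃ₐ[k] MvPolynomial (Fin 2) k) (u a b c d e g : k),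
      u ≠ 0 ∧ .C u * σ f = unfolding a b c d e g := by
  have h0 := h.degree_X
  have h1 := h.degree_Y
  have h3 := h.onePlace.coeff_single_degreeOf_ne_zero (i := 0) (by omega)
  have h4 := h.onePlace.coeff_single_degreeOf_ne_zero (i := 1) (by omega)
  have hweight (d) (hd : d ∈ f.support) := h.onePlace.weight_le (by omega) (by omega)
    (by rw [h0, h1]; norm_num) hd
  simp only [h0, h1] at h3 h4 hweight
  obtain ⟨E, F, D, hE, hF, hD, hD4, hf⟩ := exists_eq_cubic h0 hweight h3
  obtain ⟨σ, u, B, D', hu, hB, hD', hD'4, hσ⟩ :=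
    exists_algEquiv_eq_depressedCubic h3 hE hF hD (hD4 ▸ h4)
  obtain ⟨τ, a, b, c, d, e, g, hτ⟩ := PlaneCurve.exists_algEquiv_eq_unfolding hB hD' hD'4
  refine ⟨σ.trans τ, u, a, b, c, d, e, g, hu, ?_⟩
  rw [← hτ, ← hσ, ← hf, map_mul, AlgEquiv.trans_apply]
  congr 1
  exact (τ.commutes u).symm

end NormalForm

section Parametrization

variable {k : Type*} [Field k] {f g : MvPolynomial (Fin 2) k} {u v : k[X]}

open IntermediateField in
theorem adjoin_pair_eq_top_of_coprime_natDegree (h : u.natDegree.Coprime v.natDegree) :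
    adjoin k {algebraMap k[X] (RatFunc k) u, algebraMap k[X] (RatFunc k) v} = ⊤ := by
  rw [← finrank_eq_one_iff_eq_top]
  have hdvd (p : k[X]) (hp : p ∈ ({u, v} : Set k[X])) : Module.finrank
      (adjoin k {algebraMap k[X] (RatFunc k) u, algebraMap k[X] (RatFunc k) v}) (RatFunc k) ∣
        p.natDegree := by
    have := finrank_dvd_of_le_left (adjoin.mono k {algebraMap k[X] (RatFunc k) p}
      {algebraMap k[X] (RatFunc k) u, algebraMap k[X] (RatFunc k) v} (by
        rcases hp with rfl | rfl <;> simp))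
    rwa [RatFunc.finrank_eq_max_natDegree, RatFunc.num_algebraMap, RatFunc.denom_algebraMap,
      natDegree_one, Nat.max_zero] at this
  exact Nat.eq_one_of_dvd_coprimes h (hdvd u (by simp)) (hdvd v (by simp))

theorem eq_zero_of_eval₂_aeval_eq_zero (hu : u ≠ 0) (h : u.natDegree.Coprime v.natDegree)
    {r : k[X][X]} (hr : r.natDegree < v.natDegree)
    (h0 : eval₂ (aeval (R := k) v : k[X] →+* k[X]) u r = 0) : r = 0 := by
  rw [eval₂_eq_sum_range' _ hr] at h0
  have hdeg (i : ℕ) (hi : (aeval v (r.coeff i) : k[X]) * u ^ i ≠ 0) :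
      ((aeval v (r.coeff i) : k[X]) * u ^ i).natDegree =
        (r.coeff i).natDegree * v.natDegree + i * u.natDegree := by
    rw [natDegree_mul (left_ne_zero_of_mul hi) (right_ne_zero_of_mul hi), ← comp_eq_aeval,
      natDegree_comp, natDegree_pow]
  have hdisj : Set.Pairwise {i | i ∈ Finset.range v.natDegree ∧
      (aeval v (r.coeff i) : k[X]) * u ^ i ≠ 0}
      (Function.onFun Ne (degree ∘ fun i => (aeval v (r.coeff i) : k[X]) * u ^ i)) := by
    rintro i ⟨hi, hi0⟩ j ⟨hj, hj0⟩ hij heq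
    have heq : _ = _ := natDegree_eq_natDegree heq
    rw [hdeg i hi0, hdeg j hj0] at heq
    have hmod : u.natDegree * i ≡ u.natDegree * j [MOD v.natDegree] := by
      have := congrArg (· % v.natDegree) heq
      simpa [Nat.ModEq, Nat.mul_comm] using this
    exact hij ((hmod.cancel_left_of_coprime h.symm).eq_of_lt_of_lt (Finset.mem_range.1 hi)
      (Finset.mem_range.1 hj))
  have hsup := degree_sum_eq_of_disjoint _ _ hdisj
  rw [show ∑ i ∈ Finset.range v.natDegree, (aeval v (r.coeff i) : k[X]) * u ^ i = 0 from h0,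
    degree_zero, eq_comm, Finset.sup_eq_bot_iff] at hsup
  ext1 i
  rw [coeff_zero]
  by_cases hi : i < v.natDegree
  · have hi0 : aeval v (r.coeff i) = 0 :=
      (mul_eq_zero.1 (degree_eq_bot.1 (hsup i (Finset.mem_range.2 hi)))).resolve_right
        (pow_ne_zero _ hu)
    rcases comp_eq_zero_iff.1 (comp_eq_aeval.trans hi0) with h | ⟨-, h⟩
    · exact h
    · rw [h, natDegree_C] at hi
      omega
  · exact coeff_eq_zero_of_natDegree_lt (by omega)

theorem ker_aeval_eq_span (hu : u ≠ 0) (h : u.natDegree.Coprime v.natDegree)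
    (hg : (toPoly 0 g).Monic) (hdeg : g.degreeOf 0 = v.natDegree) (hv : v.natDegree ≠ 0)
    (h0 : MvPolynomial.aeval ![u, v] g = 0) :
    RingHom.ker (MvPolynomial.aeval ![u, v] : MvPolynomial (Fin 2) k →ₐ[k] k[X]) =
      Ideal.span {g} := by
  have heval (p) : eval₂ (aeval (R := k) v : k[X] →+* k[X]) u (toPoly 0 p) =
      MvPolynomial.aeval ![u, v] p := eval₂_toPoly (by decide : (1 : Fin 2) ≠ 0) ![u, v] p
  rw [← natDegree_toPoly] at hdeg
  refine le_antisymm (fun p hp => ?_) ((Ideal.span_singleton_le_iff_mem _).2 h0)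
  rw [Ideal.mem_span_singleton, ← map_dvd_iff (toPoly (R := k) 0), ← modByMonic_eq_zero_iff_dvd hg]
  refine eq_zero_of_eval₂_aeval_eq_zero hu h ?_ ?_
  · rw [← hdeg]
    exact natDegree_modByMonic_lt _ hg fun h1 => hv (by rw [← hdeg, h1, natDegree_one])
  · rw [← heval] at h0
    rw [RingHom.mem_ker, ← heval] at hp
    rwa [← modByMonic_add_div (toPoly 0 p) (toPoly 0 g), eval₂_add, eval₂_mul, h0, zero_mul,
      add_zero] at hp

theorem ker_aeval_algEquiv (σ : MvPolynomial (Fin 2) k ≃ₐ[k] MvPolynomial (Fin 2) k)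
    (h : RingHom.ker (MvPolynomial.aeval (R := k)
      ![MvPolynomial.aeval ![u, v] (σ (.X 0)), MvPolynomial.aeval ![u, v] (σ (.X 1))]) =
        Ideal.span {g}) :
    RingHom.ker (MvPolynomial.aeval (R := k) ![u, v]) = Ideal.span {σ g} := by
  have hσ : MvPolynomial.aeval (R := k)
      ![MvPolynomial.aeval ![u, v] (σ (.X 0)), MvPolynomial.aeval ![u, v] (σ (.X 1))] =
        (MvPolynomial.aeval ![u, v]).comp σ.toAlgHom := by
    refine MvPolynomial.algHom_ext fun i => ?_
    fin_cases i <;> simp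
  ext p
  obtain ⟨p, rfl⟩ := σ.surjective p
  rw [Ideal.mem_span_singleton, map_dvd_iff, ← Ideal.mem_span_singleton, ← h, hσ]
  rfl

/-- The curve `f = 0` has the parametric form `x = u(t)`, `y = v(t)` after an automorphism of the
plane. -/
def HasParametricForm (f : MvPolynomial (Fin 2) k) (u v : k[X]) : Prop :=
  ∃ σ : MvPolynomial (Fin 2) k ≃ₐ[k] MvPolynomial (Fin 2) k, IsParametrizedBy (σ f) u v

theorem HasParametricForm.of_C_mul_algEquiv {c : k} (hc : c ≠ 0)
    {σ : MvPolynomial (Fin 2) k ≃ₐ[k] MvPolynomial (Fin 2) k}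
    (h : HasParametricForm (.C c * σ f) u v) : HasParametricForm f u v := by
  obtain ⟨τ, hker, hadj⟩ := h
  refine ⟨σ.trans τ, ?_, hadj⟩
  rw [hker, map_mul, show τ (.C c) = .C c from τ.commutes c, span_singleton_C_mul hc]
  rfl

theorem hasParametricForm_depressedCubic {B D : k[X]} (l m : kˣ) (A : k[X]) (r : k)
    (h : u.natDegree.Coprime v.natDegree) (hv : v.natDegree = 3)
    (hA : A.natDegree * v.natDegree < u.natDegree)
    (hB : (C (l : k) * u + A.comp v) ^ 3 +
      3 * (C (l : k) * u + A.comp v) * B.comp (C (m : k) * v + C r) +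
        D.comp (C (m : k) * v + C r) = 0) :
    HasParametricForm (depressedCubic B D) u v := by
  have h10 : (1 : Fin 2) ≠ 0 := by decide
  have hl : (l : k) ≠ 0 := l.ne_zero
  have hm : (m : k) ≠ 0 := m.ne_zero
  have hdegU : (C (l : k) * u + A.comp v).natDegree = u.natDegree := by
    rw [natDegree_add_eq_left_of_natDegree_lt, natDegree_C_mul hl]
    rwa [natDegree_C_mul hl, natDegree_comp]
  have hdegV : (C (m : k) * v + C r).natDegree = v.natDegree := by
    rw [natDegree_add_C, natDegree_C_mul hm]
  have htoPoly : toPoly 0 (depressedCubic B D) = X ^ 3 + C (3 * B) * X + C D := by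
    simp only [depressedCubic, map_add, map_mul, map_pow, map_ofNat, toPoly_X_self,
      toPoly_toMvPolynomial h10]
    ring
  refine ⟨triangularEquiv l m A r, ker_aeval_algEquiv _ ?_,
    adjoin_pair_eq_top_of_coprime_natDegree h⟩
  simp only [triangularEquiv_X_zero, triangularEquiv_X_one, map_add, map_mul,
    MvPolynomial.aeval_toMvPolynomial, MvPolynomial.algHom_C, MvPolynomial.aeval_X,
    ← comp_eq_aeval, algebraMap_eq, Matrix.cons_val_zero, Matrix.cons_val_one]
  refine ker_aeval_eq_span (ne_zero_of_natDegree_gt (n := 0) (by omega)) (by rwa [hdegU, hdegV])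
    ?_ ?_ (by omega) ?_
  · rw [htoPoly]
    monicity!
  · rw [← natDegree_toPoly, htoPoly, hdegV, hv]
    compute_degree!
  · simpa [depressedCubic, MvPolynomial.aeval_toMvPolynomial, ← comp_eq_aeval] using hB

theorem hasParametricForm_unfolding_of_milnorPencil_eq [IsAlgClosed k] [CharZero k]
    {a b c d e g : k}
    (h : milnorPencil (unfolding a b c d e g) = tjurina (unfolding a b c d e g) + 1) :
    (∃ l : k, (l = 0 ∨ l = -8 ∨ l = -9) ∧
      HasParametricForm (unfolding a b c d e g) (X ^ 4 + C l * X ^ 2) (X ^ 3 - 3 * X ^ 2)) ∨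
    HasParametricForm (unfolding a b c d e g)
      ((X ^ 2 - 1) * (X ^ 2 + C (-1))) ((X ^ 2 - 1) * (X + C 0)) := by
  have hu (l : k) : (X ^ 4 + C l * X ^ 2).natDegree = 4 := by compute_degree!
  have hv : (X ^ 3 - 3 * X ^ 2 : k[X]).natDegree = 3 := by compute_degree!
  have hu' : ((X ^ 2 - 1) * (X ^ 2 + C (-1)) : k[X]).natDegree = 4 := by compute_degree!
  have hv' : ((X ^ 2 - 1) * (X + C 0) : k[X]).natDegree = 3 := by compute_degree!
  have hlin (m n : k) : (C m * X + C n).natDegree * 3 < 4 := by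
    have := natDegree_linear_le (a := m) (b := n)
    omega
  obtain ⟨s, hs, h | h | h | h⟩ := unfolding_eq_of_milnorPencil_eq h <;> rw [h]
  case' inl =>
    refine .inl ⟨-8, by simp, hasParametricForm_depressedCubic (.mk0 (-s ^ 4) (by simpa))
      (.mk0 (s ^ 3) (by simpa)) (C (4 * s ^ 4) * X + C (3 * s ^ 4)) (2 * s ^ 3)
      (by rw [hu, hv]; norm_num) hv (by rw [hu, hv]; exact hlin _ _) ?_⟩
  case' inr.inl =>
    refine .inr (hasParametricForm_depressedCubic (.mk0 (-81 * s ^ 4) (by simpa))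
      (.mk0 (27 * s ^ 3) (by simpa)) (C 0 * X + C (27 * s ^ 4)) 0
      (by rw [hu', hv']; norm_num) hv' (by rw [hu', hv']; exact hlin _ _) ?_)
  case' inr.inr.inl =>
    refine .inl ⟨-9, by simp, hasParametricForm_depressedCubic (.mk0 (-16 * s ^ 4) (by simpa))
      (.mk0 (8 * s ^ 3) (by simpa)) (C (64 * s ^ 4) * X + C 0) (4 * s ^ 3)
      (by rw [hu, hv]; norm_num) hv (by rw [hu, hv]; exact hlin _ _) ?_⟩
  case' inr.inr.inr =>
    refine .inl ⟨0, by simp, hasParametricForm_depressedCubic (.mk0 (-s ^ 4) (by simpa))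
      (.mk0 (s ^ 3) (by simpa)) (C (4 * s ^ 4) * X + C (27 * s ^ 4)) (14 * s ^ 3)
      (by rw [hu, hv]; norm_num) hv (by rw [hu, hv]; exact hlin _ _) ?_⟩
  all_goals
    simp only [Units.val_mk0, add_comp, mul_comp, neg_comp, pow_comp, zero_comp, ofNat_comp, C_comp,
      X_comp, map_neg, map_mul, map_pow, map_zero, map_one, map_ofNat]
    ring

theorem IsSituationTwo.hasParametricForm [IsAlgClosed k] [CharZero k] [Fact (Irreducible f)]
    (h : IsSituationTwo f) :
    (∃ l : k, (l = 0 ∨ l = -8 ∨ l = -9) ∧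
      HasParametricForm f (X ^ 4 + C l * X ^ 2) (X ^ 3 - 3 * X ^ 2)) ∨
    HasParametricForm f ((X ^ 2 - 1) * (X ^ 2 + C (-1))) ((X ^ 2 - 1) * (X + C 0)) := by
  obtain ⟨σ, r, a, b, c, d, e, g, hr, hσ⟩ := h.exists_algEquiv_eq_unfolding
  have hμ : milnorPencil (unfolding a b c d e g) = tjurina (unfolding a b c d e g) + 1 := by
    rw [← hσ, milnorPencil_C_mul hr, tjurina_C_mul hr, milnorPencil_algEquiv, tjurina_algEquiv,
      h.milnor_eq]
  have hform := hasParametricForm_unfolding_of_milnorPencil_eq hμ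
  rw [← hσ] at hform
  exact hform.imp (fun ⟨l, hl, hf⟩ => ⟨l, hl, hf.of_C_mul_algEquiv hr⟩)
    fun hf => hf.of_C_mul_algEquiv hr

end Parametrization

section LinePlaces

open IsLocalRing

section LocalRing

variable {k S : Type*} [Field k] [CommRing S] [IsLocalRing S] [Algebra k[X] S] {c : k}

theorem under_maximalIdeal_eq_span (hc : algebraMap k[X] S (X - C c) ∈ maximalIdeal S) :
    (maximalIdeal S).under k[X] = Ideal.span {X - C c} :=
  have := PrincipalIdealRing.isMaximal_of_irreducible (irreducible_X_sub_C c)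
  (this.eq_of_le (Ideal.IsPrime.under k[X] (maximalIdeal S)).ne_top
    ((Ideal.span_singleton_le_iff_mem _).2 hc)).symm

theorem algebraMap_mem_maximalIdeal_iff
    (hc : algebraMap k[X] S (X - C c) ∈ maximalIdeal S) {p : k[X]} :
    algebraMap k[X] S p ∈ maximalIdeal S ↔ p.IsRoot c := by
  rw [← Ideal.mem_under, under_maximalIdeal_eq_span hc, Ideal.mem_span_singleton, dvd_iff_isRoot]

end LocalRing

variable {k K : Type*} [Field k] [Field K] [Algebra k[X] K] [IsFractionRing k[X] K]

theorem exists_valuationSubring_X_sub_C_mem_nonunits (c : k) : ∃ V : ValuationSubring K,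
    V ≠ ⊤ ∧ (∀ p, algebraMap k[X] K p ∈ V) ∧ algebraMap k[X] K (X - C c) ∈ V.nonunits := by
  have hinj := FaithfulSMul.algebraMap_injective k[X] K
  have hint : ¬ IsIntegral k[X] (algebraMap k[X] K (X - C c))⁻¹ := fun h => by
    obtain ⟨p, hp⟩ := IsIntegrallyClosed.isIntegral_iff.1 h
    refine (irreducible_X_sub_C c).not_isUnit (.of_mul_eq_one p (hinj ?_))
    rw [map_mul, hp, map_one, mul_inv_cancel₀]
    exact (map_ne_zero_iff _ hinj).2 (X_sub_C_ne_zero c)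
  obtain ⟨V, hV, hinv⟩ : ∃ V : ValuationSubring K,
      (∀ p, algebraMap k[X] K p ∈ V) ∧ (algebraMap k[X] K (X - C c))⁻¹ ∉ V := by
    contrapose! hint
    exact isIntegral_of_forall_mem_valuationSubring hint
  refine ⟨V, ?_, hV, V.mem_nonunits_iff_or.2 (.inr hinv)⟩
  rintro rfl
  exact hinv trivial

variable {V : ValuationSubring K} [Algebra k[X] V] [IsScalarTower k[X] V K] {c : k}

theorem exists_algebraMap_X_sub_C_mem_maximalIdeal [IsAlgClosed k] (hV : V ≠ ⊤) :
    ∃ c : k, algebraMap k[X] V (X - C c) ∈ maximalIdeal V := by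
  have hbot : (maximalIdeal V).under k[X] ≠ ⊥ := fun hbot => hV <| top_unique fun z _ => by
    obtain ⟨p, q, hq, rfl⟩ := IsFractionRing.div_surjective k[X] z
    have hunit : IsUnit (algebraMap k[X] V q) := by
      by_contra h
      rw [← mem_nonunits_iff, ← mem_maximalIdeal, ← Ideal.mem_under, hbot] at h
      exact nonZeroDivisors.ne_zero hq h
    obtain ⟨w, hw⟩ := hunit.exists_right_inv
    have hw' : algebraMap k[X] K q * w = 1 := by
      rw [IsScalarTower.algebraMap_apply k[X] V K q]
      exact congrArg Subtype.val hw
    rw [div_eq_mul_inv, ← eq_inv_of_mul_eq_one_right hw', IsScalarTower.algebraMap_apply k[X] V K p]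
    exact (algebraMap k[X] V p * w).2
  obtain ⟨p, hpm, hp⟩ := Ideal.IsPrime.exists_mem_prime_of_ne_bot inferInstance hbot
  obtain ⟨c, hc⟩ := IsAlgClosed.exists_root p
    (by simp [IsAlgClosed.degree_eq_one_of_irreducible k hp.irreducible])
  have hassoc := (irreducible_X_sub_C c).associated_of_dvd hp.irreducible (dvd_iff_isRoot.2 hc)
  exact ⟨c, Ideal.mem_of_dvd ((maximalIdeal V).under k[X]) hassoc.symm.dvd hpm⟩

theorem maximalIdeal_eq_span (hc : algebraMap k[X] V (X - C c) ∈ maximalIdeal V) :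
    maximalIdeal V = Ideal.span {algebraMap k[X] V (X - C c)} := by
  refine le_antisymm (fun z hz => ?_) ((Ideal.span_singleton_le_iff_mem _).2 hc)
  obtain ⟨p, q, hpq, hz'⟩ := IsFractionRing.exists_reduced_fraction k[X] (z : K)
  have hmul : z * algebraMap k[X] V q = algebraMap k[X] V p := by
    apply Subtype.ext
    change (z : K) * algebraMap V K (algebraMap k[X] V q) = algebraMap V K (algebraMap k[X] V p)
    rw [← IsScalarTower.algebraMap_apply, ← IsScalarTower.algebraMap_apply, ← hz',
      IsLocalization.mk'_spec]
  have hp : p.IsRoot c := (algebraMap_mem_maximalIdeal_iff hc).1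
    (hmul ▸ Ideal.mul_mem_right _ _ hz)
  have hq : ¬ (q : k[X]).IsRoot c := fun hq => (irreducible_X_sub_C c).not_isUnit
    (hpq (dvd_iff_isRoot.2 hp) (dvd_iff_isRoot.2 hq))
  rw [← algebraMap_mem_maximalIdeal_iff hc, mem_maximalIdeal, mem_nonunits_iff, not_not] at hq
  rw [Ideal.mem_span_singleton, ← hq.dvd_mul_right, hmul]
  exact map_dvd _ (dvd_iff_isRoot.2 hp)

theorem algebraMap_mem_maximalIdeal_sq_iff
    (hc : algebraMap k[X] V (X - C c) ∈ maximalIdeal V) {p : k[X]} :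
    algebraMap k[X] V p ∈ maximalIdeal V ^ 2 ↔ p.IsRoot c ∧ p.derivative.IsRoot c := by
  by_cases hp : p.IsRoot c
  · obtain ⟨q, rfl⟩ := dvd_iff_isRoot.2 hp
    have h0 : algebraMap k[X] V (X - C c) ≠ 0 := fun h0 => X_sub_C_ne_zero c <|
      FaithfulSMul.algebraMap_injective k[X] K (by
        rw [IsScalarTower.algebraMap_apply k[X] V K, h0, map_zero, map_zero])
    have hq : (derivative ((X - C c) * q)).IsRoot c ↔ q.IsRoot c := by simp
    rw [maximalIdeal_eq_span hc, Ideal.span_singleton_pow, Ideal.mem_span_singleton, map_mul, sq,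
      mul_dvd_mul_iff_left h0, ← Ideal.mem_span_singleton, ← maximalIdeal_eq_span hc,
      algebraMap_mem_maximalIdeal_iff hc, hq, and_iff_right hp]
  · refine iff_of_false (fun h => hp ?_) (fun h => hp h.1)
    exact (algebraMap_mem_maximalIdeal_iff hc).1 (Ideal.pow_le_self two_ne_zero h)

end LinePlaces

section SingularBranches

variable {k : Type*} [Field k] {u v : k[X]}

theorem forall_isRoot_derivative_aeval_iff {c : k} :
    (∀ g : MvPolynomial (Fin 2) k, (MvPolynomial.aeval ![u, v] g).IsRoot c →
      (MvPolynomial.aeval ![u, v] g).derivative.IsRoot c) ↔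
        u.derivative.IsRoot c ∧ v.derivative.IsRoot c := by
  constructor
  · intro h
    have hX (i : Fin 2) : (![u, v] i).derivative.IsRoot c := by
      have := h (.X i - .C ((![u, v] i).eval c))
      simpa [MvPolynomial.algHom_C] using this
    exact ⟨hX 0, hX 1⟩
  · rintro ⟨hu, hv⟩ g -
    have := derivation_aeval derivative' ![u, v] g
    simpa [hu.eq_zero, hv.eq_zero] using congrArg (eval c) this

variable {f : MvPolynomial (Fin 2) k} [Fact (Irreducible f)]
  {σ : MvPolynomial (Fin 2) k ≃ₐ[k] MvPolynomial (Fin 2) k}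

namespace IsParametrizedBy

theorem exists_algEquiv_ratFunc (h : IsParametrizedBy (σ f) u v) :
    ∃ e : FunctionField f ≃ₐ[k] RatFunc k, ∀ g, e (toFunctionField f g) =
      algebraMap k[X] (RatFunc k) (MvPolynomial.aeval ![u, v] (σ g)) := by
  obtain ⟨hker, hadj⟩ := h
  have hmem (g : MvPolynomial (Fin 2) k) :
      MvPolynomial.aeval ![u, v] (σ g) = 0 ↔ g ∈ Ideal.span {f} := by
    rw [← RingHom.mem_ker, hker, Ideal.mem_span_singleton, Ideal.mem_span_singleton, map_dvd_iff]
  let φ : CoordRing f →ₐ[k] RatFunc k := (IsScalarTower.toAlgHom k k[X] (RatFunc k)).comp <|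
    Ideal.Quotient.liftₐ (Ideal.span {f}) ((MvPolynomial.aeval ![u, v]).comp σ.toAlgHom)
      fun g hg => (hmem g).2 hg
  have hφ : Function.Injective φ := (RatFunc.algebraMap_injective k).comp <|
    RingHom.lift_injective_of_ker_le_ideal _ (fun g hg => (hmem g).2 hg) fun g hg => (hmem g).1 hg
  have hL (g : MvPolynomial (Fin 2) k) : IsFractionRing.liftAlgHom hφ (toFunctionField f g) =
      algebraMap k[X] (RatFunc k) (MvPolynomial.aeval ![u, v] (σ g)) :=
    IsFractionRing.lift_algebraMap hφ _
  have hsurj : Function.Surjective (IsFractionRing.liftAlgHom (K := FunctionField f) hφ) := by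
    rw [← AlgHom.fieldRange_eq_top, eq_top_iff, ← hadj, IntermediateField.adjoin_le_iff]
    have hX (i : Fin 2) : algebraMap k[X] (RatFunc k) (![u, v] i) ∈
        (IsFractionRing.liftAlgHom (K := FunctionField f) hφ).fieldRange :=
      ⟨toFunctionField f (σ.symm (.X i)), (hL _).trans <| by
        rw [AlgEquiv.apply_symm_apply, MvPolynomial.aeval_X]⟩
    rintro _ (rfl | rfl)
    exacts [hX 0, hX 1]
  exact ⟨.ofBijective _ ⟨RingHom.injective _, hsurj⟩, hL⟩

theorem exists_algebra (h : IsParametrizedBy (σ f) u v) :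
    ∃ (_ : Algebra k[X] (FunctionField f)) (_ : IsScalarTower k k[X] (FunctionField f)),
      IsFractionRing k[X] (FunctionField f) ∧ ∀ g, toFunctionField f g =
        algebraMap k[X] (FunctionField f) (MvPolynomial.aeval ![u, v] (σ g)) := by
  obtain ⟨e, he⟩ := h.exists_algEquiv_ratFunc
  let _ : Algebra k[X] (FunctionField f) :=
    (e.symm.toRingHom.comp (algebraMap k[X] (RatFunc k))).toAlgebra
  refine ⟨inferInstance, .of_algebraMap_eq fun c => ?_, ?_, fun g => ?_⟩
  · exact (e.symm.commutes c).symm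
  · exact .of_algEquiv (AlgEquiv.ofRingEquiv (f := e.symm.toRingEquiv) fun _ => rfl)
  · exact e.eq_symm_apply.2 (he g)

end IsParametrizedBy

section Algebra

-- A shortcut: the search otherwise times out on the `SMul` instances of localizations.
noncomputable instance (V : ValuationSubring (FunctionField f)) : SMul V (FunctionField f) :=
  Algebra.toSMul

variable [Algebra k[X] (FunctionField f)] {V : ValuationSubring (FunctionField f)}

theorem IsFiniteBranch.algebraMap_mem [IsScalarTower k k[X] (FunctionField f)]
    (hV : IsFiniteBranch f V)
    (hf : ∀ g, toFunctionField f g = algebraMap k[X] _ (MvPolynomial.aeval ![u, v] (σ g)))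
    (hu : u.natDegree ≠ 0) (p : k[X]) : algebraMap k[X] (FunctionField f) p ∈ V := by
  have huV : V.valuation (aeval (algebraMap k[X] (FunctionField f) X) u) ≤ 1 := by
    rw [aeval_algebraMap_apply, aeval_X_left_apply, V.valuation_le_one_iff]
    have := hV.2 (Ideal.Quotient.mk _ (σ.symm (.X 0)))
    rwa [← toFunctionField_apply, hf, AlgEquiv.apply_symm_apply, MvPolynomial.aeval_X] at this
  have hX : algebraMap k[X] (FunctionField f) X ∈ V := by
    have := isTrivialOn_valuation hV.1.1
    contrapose! huV
    rw [← one_lt_valuation_iff] at huV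
    rw [valuation_aeval_eq_valuation_X_pow_natDegree_of_one_lt_valuation_X (A := k) _ huV
      (ne_zero_of_natDegree_gt (Nat.pos_of_ne_zero hu))]
    exact one_lt_pow₀ huV hu
  induction p using Polynomial.induction_on' with
  | add p q hp hq => rw [map_add]; exact add_mem hp hq
  | monomial n c =>
    rw [← C_mul_X_pow_eq_monomial, map_mul, map_pow]
    refine mul_mem ?_ (pow_mem hX n)
    rw [← algebraMap_eq, ← IsScalarTower.algebraMap_apply]
    exact hV.1.1 c

theorem isFiniteBranch_of_forall_mem [IsScalarTower k k[X] (FunctionField f)] (hV : V ≠ ⊤)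
    (hp : ∀ p, algebraMap k[X] _ p ∈ V)
    (hf : ∀ g, toFunctionField f g = algebraMap k[X] _ (MvPolynomial.aeval ![u, v] (σ g))) :
    IsFiniteBranch f V := by
  have hk (c : k) : algebraMap k (FunctionField f) c ∈ V := by
    rw [IsScalarTower.algebraMap_apply k k[X]]
    exact hp _
  exact ⟨⟨hk, hV⟩, (forall_algebraMap_mem_iff hk).2 fun i => hf _ ▸ hp _⟩

theorem IsFiniteBranch.isSingularBranch_iff [IsFractionRing k[X] (FunctionField f)]
    [Algebra k[X] V] [IsScalarTower k[X] V (FunctionField f)] {c : k}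
    (hV : IsFiniteBranch f V) (hc : algebraMap k[X] V (X - C c) ∈ IsLocalRing.maximalIdeal V)
    (hf : ∀ g, toFunctionField f g = algebraMap k[X] _ (MvPolynomial.aeval ![u, v] (σ g))) :
    IsSingularBranch f V ↔ u.derivative.IsRoot c ∧ v.derivative.IsRoot c := by
  have hval (g : MvPolynomial (Fin 2) k) (h : toFunctionField f g ∈ V) :
      (⟨toFunctionField f g, h⟩ : V) = algebraMap k[X] V (MvPolynomial.aeval ![u, v] (σ g)) :=
    Subtype.ext ((hf g).trans (IsScalarTower.algebraMap_apply k[X] V _ _))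
  rw [IsSingularBranch, and_iff_right hV, ← forall_isRoot_derivative_aeval_iff]
  constructor
  · intro h g hg
    obtain ⟨g, rfl⟩ := σ.surjective g
    have := h (Ideal.Quotient.mk _ g) (hV.2 _)
    simp only [← toFunctionField_apply, hval, algebraMap_mem_maximalIdeal_iff hc,
      algebraMap_mem_maximalIdeal_sq_iff hc] at this
    exact (this hg).2
  · intro h r hr
    obtain ⟨g, rfl⟩ := Ideal.Quotient.mk_surjective r
    simp only [← toFunctionField_apply, hval, algebraMap_mem_maximalIdeal_iff hc,
      algebraMap_mem_maximalIdeal_sq_iff hc]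
    exact fun hg => ⟨hg, h _ hg⟩

end Algebra

theorem IsParametrizedBy.exists_isSingularBranch_iff [IsAlgClosed k]
    (h : IsParametrizedBy (σ f) u v) (hu : u.natDegree ≠ 0) :
    (∃ V, IsSingularBranch f V) ↔ ∃ c, u.derivative.IsRoot c ∧ v.derivative.IsRoot c := by
  obtain ⟨_, _, _, hf⟩ := h.exists_algebra
  constructor
  · rintro ⟨V, hV⟩
    let _ : Algebra k[X] V := ((algebraMap k[X] (FunctionField f)).codRestrict V
      (hV.1.algebraMap_mem hf hu)).toAlgebra
    have : IsScalarTower k[X] V (FunctionField f) := .of_algebraMap_eq fun _ => rfl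
    obtain ⟨c, hc⟩ := exists_algebraMap_X_sub_C_mem_maximalIdeal (k := k) hV.1.1.2
    exact ⟨c, (hV.1.isSingularBranch_iff hc hf).1 hV⟩
  · rintro ⟨c, hc⟩
    obtain ⟨V, htop, hV, hcV⟩ :=
      exists_valuationSubring_X_sub_C_mem_nonunits (K := FunctionField f) c
    let _ : Algebra k[X] V := ((algebraMap k[X] (FunctionField f)).codRestrict V hV).toAlgebra
    have : IsScalarTower k[X] V (FunctionField f) := .of_algebraMap_eq fun _ => rfl
    obtain ⟨_, hcV⟩ := V.mem_nonunits_iff_exists_mem_maximalIdeal.1 hcV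
    exact ⟨V, ((isFiniteBranch_of_forall_mem htop hV hf).isSingularBranch_iff hcV hf).2 hc⟩

end SingularBranches

section CriticalPoints

variable {k : Type*} [Field k]

theorem isRoot_derivative_zero_of_X_sq_dvd {p : k[X]} (h : X ^ 2 ∣ p) :
    p.derivative.IsRoot 0 := by
  obtain ⟨q, rfl⟩ := h
  simp

theorem not_isRoot_derivative_tacnode (h2 : (2 : k) ≠ 0) (c : k) :
    ¬ (((X ^ 2 - 1) * (X ^ 2 + C (-1)) : k[X]).derivative.IsRoot c ∧
      ((X ^ 2 - 1) * (X + C 0) : k[X]).derivative.IsRoot c) := by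
  rintro ⟨hu, hv⟩
  simp only [IsRoot.def, derivative_mul, derivative_sub, derivative_add, derivative_X_sq,
    derivative_one, derivative_C, derivative_X, eval_add, eval_mul, eval_sub, eval_pow, eval_X,
    eval_C, eval_one, eval_zero] at hu hv
  have hc : 2 ^ 3 * c = 0 := by linear_combination 4 * c * hv - 3 * hu
  obtain rfl : c = 0 := (mul_eq_zero.1 hc).resolve_left (pow_ne_zero 3 h2)
  simp at hv

end CriticalPoints

end PlaneCurve

theorem lemma7p5 {k : Type*} [Field k] [IsAlgClosed k] [CharZero k]
    (f : MvPolynomial (Fin 2) k) [Fact (Irreducible f)] (hf : PlaneCurve.IsSituationTwo f) :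
    ((∃ V : ValuationSubring (PlaneCurve.FunctionField f), PlaneCurve.IsSingularBranch f V) →
      ∃ (σ : MvPolynomial (Fin 2) k ≃ₐ[k] MvPolynomial (Fin 2) k) (a : k),
        (a = 0 ∨ a = -8 ∨ a = -9) ∧
        PlaneCurve.IsParametrizedBy (σ f)
          (Polynomial.X ^ 4 + Polynomial.C a * Polynomial.X ^ 2)
          (Polynomial.X ^ 3 - 3 * Polynomial.X ^ 2)) ∧
    ((¬ ∃ V : ValuationSubring (PlaneCurve.FunctionField f), PlaneCurve.IsSingularBranch f V) →
      ∃ (σ : MvPolynomial (Fin 2) k ≃ₐ[k] MvPolynomial (Fin 2) k) (a b : k),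
        (a = -1 ∧ b ≠ 1 ∧ b ≠ -1) ∧
        PlaneCurve.IsParametrizedBy (σ f)
          ((Polynomial.X ^ 2 - 1) * (Polynomial.X ^ 2 + Polynomial.C a))
          ((Polynomial.X ^ 2 - 1) * (Polynomial.X + Polynomial.C b))) := by
  rcases hf.hasParametricForm with ⟨a, ha, σ, h⟩ | ⟨σ, h⟩
  · have hdeg : (Polynomial.X ^ 4 + Polynomial.C a * Polynomial.X ^ 2).natDegree = 4 := by
      compute_degree!
    refine ⟨fun _ => ⟨σ, a, ha, h⟩, fun hV => (hV ?_).elim⟩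
    rw [h.exists_isSingularBranch_iff (by omega)]
    exact ⟨0, PlaneCurve.isRoot_derivative_zero_of_X_sq_dvd (by simp [dvd_add, pow_dvd_pow]),
      PlaneCurve.isRoot_derivative_zero_of_X_sq_dvd (by simp [dvd_sub, pow_dvd_pow])⟩
  · have hdeg : ((Polynomial.X ^ 2 - 1) *
        (Polynomial.X ^ 2 + Polynomial.C (-1 : k))).natDegree = 4 := by
      compute_degree!
    refine ⟨fun hV => ?_, fun _ => ⟨σ, -1, 0, ⟨rfl, by simp, by simp⟩, h⟩⟩
    obtain ⟨c, hc⟩ := (h.exists_isSingularBranch_iff (by omega)).1 hV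
    exact (PlaneCurve.not_isRoot_derivative_tacnode two_ne_zero c hc).elim
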